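/- \textbf{Definitions.} For a map $g$ on $\mathbb Z^2$ write $g=g(k,\ell)$, $g_1=g(k+1,\ell)$, $g_2=g(k,\ell+1)$, $g_{12}=g(k+1,\ell+1)$. A \emph{cK-net} (with $K=-1$, possibly with degenerate faces) is a pair $f:\mathbb Z^2\to\mathbb R^3$, $n:\mathbb Z^2\to\mathbb S^2$ such that (a) on every edge ($i=1,2$), $f_i-f\perp n_i+n$, and $n_i-n$ is parallel to $f_i-f$ (i.e. the two vectors are linearly dependent); (b) for every face, the four points $f,f_1,f_{12},f_2$ lie on a circle or on a straight line; (c) for every face and every unit vector $N$ orthogonal to $n_{12}-n$ and $n_2-n_1$ (a face normal), $\det(n_{12}-n,\,n_2-n_1,\,N)=-\det(f_{12}-f,\,f_2-f_1,\,N)$. The cK-net is \emph{nondegenerate} if $\det(f_{12}-f,f_2-f_1,N)\neq0$ for every face and every face normal $N$; then (c) says that the Gauss curvature $K=\det(n_{12}-n,n_2-n_1,N)/\det(f_{12}-f,f_2-f_1,N)$ equals $-1$ on every face. Let $\alpha\in(-\pi,\pi)$, $\alpha\ne0$. A cK-net $(\tilde f,\tilde n)$ is an \emph{$\alpha$-Bäcklund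 transform} of a cK-net $(f,n)$ if at every vertex $\|\tilde f-f\|=|\sin\alpha|$, $\tilde f-f\perp n,\tilde n$, and the angle from $n$ to $\tilde n$, measured about the axis directed by $\tilde f-f$, is $\alpha$ with its sign (that is, $\angle(n,\tilde n)=|\alpha|$ and $\alpha\det(n,\tilde n,\tilde f-f)>0$). Call $\alpha$ \emph{non-resonant} for $(f,n)$ if $\|f_i-f\|^2+\|n_i-n\|^2\neq4\sin^2\alpha$ on every edge; this excludes only countably many $\alpha$. \textbf{Theorem.} Let $(f,n)$ be a nondegenerate cK-net with $K=-1$. 1. Let $\alpha\in(-\pi,\pi)$, $\alpha\neq0$, let $(k_0,\ell_0)\in\mathbb Z^2$, and let $\nu$ be a unit vector with $\angle(n(k_0,\ell_0),\nu)=|\alpha|$. Then there exists an $\alpha$-Bäcklund transform $(\tilde f,\tilde n)$ of $(f,n)$ with $\tilde n(k_0,\ell_0)=\nu$. If $\alpha$ is non-resonant for $(f,n)$, it is unique. 2. Let $\hat\alpha,\tilde\alpha\in(-\pi,\pi)\setminus\{0\}$ be non-resonant for $(f,n)$, and let $(\hat f,\hat n)$ and $(\tilde f,\tilde n)$ be an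 $\hat\alpha$- and an $\tilde\alpha$-Bäcklund transform of $(f,n)$, respectively, that are not the same net up to the orientation of the Gauss map (i.e. not both $\hat f=\tilde f$ and $\hat n=\pm\tilde n$ with one global sign). Then there is a unique cK-net $(\hat{\tilde f},\hat{\tilde n})$ that is an $\tilde\alpha$-Bäcklund transform of $(\hat f,\hat n)$ as well as an $\hat\alpha$-Bäcklund transform of $(\tilde f,\tilde n)$. -/

import Mathlib

/-- Euclidean three-space. -/
abbrev E3 : Type := EuclideanSpace ℝ (Fin 3)

/-- The determinant of three vectors of Euclidean three-space. -/
def det3 (a b c : E3) : ℝ := Matrix.det (Matrix.of fun i j : Fin 3 => ![a, b, c] i j)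

/-- A net `f : ℤ² → ℝ³` together with a unit normal at every vertex. -/
@[ext]
structure GaussNet where
  /-- the vertices `f` -/
  f : ℤ → ℤ → E3
  /-- the unit normals `n` -/
  n : ℤ → ℤ → E3
  norm_n : ∀ k l, ‖n k l‖ = 1

namespace GaussNet

/-- The condition on one edge, from the vertex `p` with normal `m` to the vertex `p'` with
normal `m'`: the edge-constraint `p' - p ⊥ m + m'`, and `m' - m` is parallel to `p' - p`. -/
def EdgeCond (p m p' m' : E3) : Prop :=
  inner ℝ (p' - p) (m' + m) = 0 ∧ ¬ LinearIndependent ℝ ![p' - p, m' - m]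

/-- `(f, n)` is an edge-constraint net with parallel Gauss map. -/
def IsParallelEdgeConstraint (X : GaussNet) : Prop :=
  ∀ k l, EdgeCond (X.f k l) (X.n k l) (X.f (k + 1) l) (X.n (k + 1) l) ∧
    EdgeCond (X.f k l) (X.n k l) (X.f k (l + 1)) (X.n k (l + 1))

/-- Every face is inscribed in a circle, where a straight line counts as a circle of infinite
radius (this can only happen for degenerate faces, whose diagonals are parallel). -/
def IsCircular (X : GaussNet) : Prop :=
  ∀ k l,
    EuclideanGeometry.Concyclic
      ({X.f k l, X.f (k + 1) l, X.f (k + 1) (l + 1), X.f k (l + 1)} : Set E3) ∨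
    Collinear ℝ ({X.f k l, X.f (k + 1) l, X.f (k + 1) (l + 1), X.f k (l + 1)} : Set E3)

/-- `N` is a face normal at `(k, l)`: a unit vector orthogonal to `n₁₂ - n` and `n₂ - n₁`. -/
def IsFaceNormal (X : GaussNet) (k l : ℤ) (N : E3) : Prop :=
  ‖N‖ = 1 ∧ inner ℝ (X.n (k + 1) (l + 1) - X.n k l) N = 0 ∧
    inner ℝ (X.n k (l + 1) - X.n (k + 1) l) N = 0

/-- `det(f₁₂ - f, f₂ - f₁, N)`, twice the signed area of a face. -/
noncomputable def detF (X : GaussNet) (k l : ℤ) (N : E3) : ℝ :=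
  det3 (X.f (k + 1) (l + 1) - X.f k l) (X.f k (l + 1) - X.f (k + 1) l) N

/-- `det(n₁₂ - n, n₂ - n₁, N)`, twice the signed area of the corresponding face of `n`. -/
noncomputable def detN (X : GaussNet) (k l : ℤ) (N : E3) : ℝ :=
  det3 (X.n (k + 1) (l + 1) - X.n k l) (X.n k (l + 1) - X.n (k + 1) l) N

/-- The Gauss curvature of the face at `(k, l)`, computed with the face normal `N`. -/
noncomputable def gaussCurvature (X : GaussNet) (k l : ℤ) (N : E3) : ℝ :=
  X.detN k l N / X.detF k l N

/-- The net is nondegenerate: the denominator in the Gauss curvature vanishes on no face. -/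
def IsNondegenerate (X : GaussNet) : Prop :=
  ∀ k l N, X.IsFaceNormal k l N → X.detF k l N ≠ 0

/-- Gauss curvature `κ` on all faces, in a form free of denominators, so that it also makes
sense on degenerate faces. -/
def HasGaussCurvature (X : GaussNet) (κ : ℝ) : Prop :=
  ∀ k l N, X.IsFaceNormal k l N → X.detN k l N = κ * X.detF k l N

/-- On a nondegenerate net, `HasGaussCurvature` is the equation `K = κ` on all faces. -/
theorem hasGaussCurvature_iff (X : GaussNet) (hX : X.IsNondegenerate) (κ : ℝ) :
    X.HasGaussCurvature κ ↔
      ∀ k l N, X.IsFaceNormal k l N → X.gaussCurvature k l N = κ := by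
  constructor
  · intro h k l N hN
    exact (div_eq_iff (hX k l N hN)).2 (h k l N hN)
  · intro h k l N hN
    exact (div_eq_iff (hX k l N hN)).1 (h k l N hN)

/-- A cK-net with `K = -1`, possibly with degenerate faces: a circular edge-constraint net with
parallel Gauss map and Gauss curvature `-1`. -/
structure IsCKNet (X : GaussNet) : Prop where
  parallel : X.IsParallelEdgeConstraint
  circular : X.IsCircular
  curvature : X.HasGaussCurvature (-1)

/-- The conditions of a Bäcklund transformation with parameter `α` from `X = (f, n)` to
`Y = (f̃, ñ)`, for `0 < |α| < π`: at every vertex `‖f̃ - f‖ = |sin α|`, `f̃ - f ⊥ n, ñ`, and the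
angle from `n` to `ñ`, measured about the axis directed by `f̃ - f`, equals `α` with its sign. -/
structure IsBacklund (α : ℝ) (X Y : GaussNet) : Prop where
  dist : ∀ k l, ‖Y.f k l - X.f k l‖ = |Real.sin α|
  orth : ∀ k l, inner ℝ (Y.f k l - X.f k l) (X.n k l) = 0
  orth' : ∀ k l, inner ℝ (Y.f k l - X.f k l) (Y.n k l) = 0
  angle : ∀ k l, InnerProductGeometry.angle (X.n k l) (Y.n k l) = |α|
  sign : ∀ k l, 0 < α * det3 (X.n k l) (Y.n k l) (Y.f k l - X.f k l)

/-- `α` is non-resonant for the net: `‖fᵢ - f‖² + ‖nᵢ - n‖² ≠ 4 sin² α` on every edge. -/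
def IsNonresonant (X : GaussNet) (α : ℝ) : Prop :=
  ∀ k l,
    ‖X.f (k + 1) l - X.f k l‖ ^ 2 + ‖X.n (k + 1) l - X.n k l‖ ^ 2 ≠ 4 * Real.sin α ^ 2 ∧
    ‖X.f k (l + 1) - X.f k l‖ ^ 2 + ‖X.n k (l + 1) - X.n k l‖ ^ 2 ≠ 4 * Real.sin α ^ 2

end GaussNet

/-!
Identify `ℝ³` with the imaginary quaternions. On an edge with end normals `n, n₁` and edge vector
`a = f₁ - f`, the edge condition of a cK-net is the single equation `n₁ a + a n = 0` (`EdgeEq`).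
Attach to the edge the Lax polynomial `L(t) = 1 + t a + t² n₁ n`. For the products of these along
the two paths around a face, the coefficients of `1`, `t`, `t⁴` agree trivially and those of `t³`
agree by the edge equations. The remaining condition `FaceEq`, on the coefficient of `t²`, has as
imaginary part the vector form `(n₁₂ - n) × (n₂ - n₁) = -(f₁₂ - f) × (f₂ - f₁)` of `K = -1`.
Nondegenerate cK-nets satisfy `FaceEq` (`GaussNet.IsCKNet.isLax`): circularity enters only
through planarity of the faces, and the real part is automatic because the difference `E` of the
two sides satisfies `n₁₂ E = E n`. Conversely `EdgeEq` and `FaceEq` imply all conditions of a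
cK-net, degenerate faces included (`GaussNet.IsLax.isCKNet`).

Put `m = sign α • ñ` and `c = sign α * cos α`. An `α`-Bäcklund transform then is
`f̃ = f + n × m` with `‖m‖ = 1` and `⟪n, m⟫ = c` (`GaussNet.isBacklund_iff`), and its edge
condition reads `m₁ A + A m = 0`, where `A = a + m n - n₁ m` depends only on the edge and on `m`
(`edgeEq_transform_iff`). If `α` is non-resonant, then `A ≠ 0`, so `m₁ = -A m A⁻¹` is the unique
continuation of `m` along the edge. The product of the two factors `A` along a path around a face
depends on the path only through the coefficient in `FaceEq` (`transport_path`), so continuation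
closes up around faces, and a value at one vertex extends uniquely to the lattice. That the
transform inherits `FaceEq` follows from the edge equations (`FaceEq.transform`). For resonant `α`,
existence follows from compactness, as non-resonant values of `c` are dense.

For permutability, two fields `u, v` over the same net are combined at each vertex into the
reflection `w` of `n` in the plane orthogonal to `u - v`. This is the only candidate, and its edge
equations follow from an identity between the transport factors (`permutability_edge`). If `u = v`
at a single vertex, uniqueness of the continuation makes the two transforms agree everywhere up
to the orientation of the Gauss map.
-/

open Quaternion EuclideanGeometry

/-! ### Identities in a ring -/

section Ring

variable {R : Type*} [Ring R]

/-- The edge equation of the transform, whose edge vector is `a - u₁ n₁ + u n`, is linear in `u₁`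
with coefficient `a + u n - n₁ u`. -/
theorem edge_transform_eq {a n n₁ u u₁ : R} (hu : u * u = -1) (hu₁ : u₁ * u₁ = -1) :
    u₁ * (a - u₁ * n₁ + u * n) + (a - u₁ * n₁ + u * n) * u =
      u₁ * (a + u * n - n₁ * u) + (a + u * n - n₁ * u) * u := by
  linear_combination (norm := noncomm_ring) (-hu₁) * n₁ + n₁ * hu

/-- The transport factor `a + u n - n₁ u` intertwines `n` and `-n₁`. -/
theorem intertwine_normal {a n n₁ u : R} (hn : n * n = -1) (hn₁ : n₁ * n₁ = -1)
    (h : n₁ * a + a * n = 0) :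
    n₁ * (a + u * n - n₁ * u) = -((a + u * n - n₁ * u) * n) := by
  linear_combination (norm := noncomm_ring) h - hn₁ * u + u * hn

/-- Commutation of the Lax polynomial of an edge with the polynomial `1 - t u n` of the
transformation, in the coefficient of `t²`. -/
theorem lax_edge {a n n₁ u u₁ g : R} (hn : n * n = -1)
    (hu₁ : u₁ * u₁ = -1) (h : n₁ * a + a * n = 0) (hg : g = a - u₁ * n₁ + u * n)
    (h' : u₁ * g + g * u = 0) :
    u₁ * u = n₁ * n - u₁ * n₁ * a + g * u * n := by
  subst hg
  linear_combination (norm := noncomm_ring) u₁ * h - h' * n + u₁ * u * hn - hu₁ * n₁ * n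

/-- Commutation of the Lax polynomial of a path of two edges with the polynomial `1 - t u n` of
the transformation, in the coefficient of `t²`. Apart from the term `n₁₂ n₁ + n₁ n + b a`, the right
side involves the intermediate vertex only through `b + a` and `b' + a'`. -/
theorem lax_path {a b n n₁ n₁₂ u u₁ u₁₂ a' b' : R} (hn : n * n = -1)
    (hn₁ : n₁ * n₁ = -1) (hu₁ : u₁ * u₁ = -1) (hu₁₂ : u₁₂ * u₁₂ = -1)
    (h : n₁ * a + a * n = 0) (h₁ : n₁₂ * b + b * n₁ = 0)
    (ha : a' = a - u₁ * n₁ + u * n) (hb : b' = b - u₁₂ * n₁₂ + u₁ * n₁)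
    (h' : u₁ * a' + a' * u = 0) (h₁' : u₁₂ * b' + b' * u₁ = 0) :
    u₁₂ * u₁ + u₁ * u + b' * a' =
      n₁₂ * n₁ + n₁ * n + b * a - u₁₂ * n₁₂ * (b + a) + (b' + a') * (u * n) := by
  have e := lax_edge hn hu₁ h ha h'
  have e₁ := lax_edge hn₁ hu₁₂ h₁ hb h₁'
  rw [e, e₁]
  linear_combination (norm := noncomm_ring) b' * ha + hb * a

/-- The product of the transport factors along a path of two edges depends on the intermediate
vertex only through the term `n₁₂ n₁ + n₁ n + b a`. -/
theorem transport_path {a b n n₁ n₁₂ u u₁ : R} (hn : n * n = -1) (hu : u * u = -1)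
    (hn₁ : n₁ * n₁ = -1)
    (h : n₁ * a + a * n = 0) (h₁ : n₁₂ * b + b * n₁ = 0)
    (h' : u₁ * (a + u * n - n₁ * u) + (a + u * n - n₁ * u) * u = 0) :
    (b + u₁ * n₁ - n₁₂ * u₁) * (a + u * n - n₁ * u) =
      n₁₂ * n₁ + n₁ * n + b * a + u * n * u * n + n₁₂ * u * n * u + (b + a) * (u * n) +
        n₁₂ * (b + a) * u := by
  have e := intertwine_normal (u := u) hn hn₁ h
  linear_combination (norm := noncomm_ring)
    u₁ * e - n₁₂ * h' - h' * n - h₁ * u - n₁ * hu * n - n₁₂ * n₁ * hu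

/-- The transport factor of `w` along the edge of the transform by `u` is, up to sign, carried by
`u - v` and `u₁ - v₁` to the transport factor of `v` along the original edge. -/
theorem permutability_edge {a n n₁ u u₁ v v₁ w : R}
    (hu : u * u = -1) (hv : v * v = -1)
    (h : u₁ * (a + u * n - n₁ * u) + (a + u * n - n₁ * u) * u = 0)
    (h' : v₁ * (a + v * n - n₁ * v) + (a + v * n - n₁ * v) * v = 0)
    (hw : w * (u - v) = -((u - v) * n)) :
    (a - u₁ * n₁ + u * n + w * u - u₁ * w) * (u - v) = -((u₁ - v₁) * (a + v * n - n₁ * v)) := by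
  have e : u * (u - v) = -((u - v) * v) := by
    linear_combination (norm := noncomm_ring) hu - hv
  linear_combination (norm := noncomm_ring) w * e - hw * v + h - h' - u₁ * hw + n₁ * hu - n₁ * hv

end Ring

/-! ### Quaternions and the cross product -/

/-- The embedding of Euclidean three-space as the purely imaginary quaternions. -/
noncomputable def quat : E3 →ₗ[ℝ] ℍ[ℝ] where
  toFun x := ⟨0, x 0, x 1, x 2⟩
  map_add' _ _ := Quaternion.ext _ _ (add_zero (0 : ℝ)).symm rfl rfl rfl
  map_smul' r _ := Quaternion.ext _ _ (mul_zero r).symm rfl rfl rfl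

@[simp] theorem re_quat (x : E3) : (quat x).re = 0 := rfl
@[simp] theorem imI_quat (x : E3) : (quat x).imI = x 0 := rfl
@[simp] theorem imJ_quat (x : E3) : (quat x).imJ = x 1 := rfl
@[simp] theorem imK_quat (x : E3) : (quat x).imK = x 2 := rfl

theorem E3.inner_eq (x y : E3) : inner ℝ x y = x 0 * y 0 + x 1 * y 1 + x 2 * y 2 := by
  simp [PiLp.inner_apply, Fin.sum_univ_three, mul_comm]

theorem E3.norm_sq_eq (x : E3) : ‖x‖ ^ 2 = x 0 ^ 2 + x 1 ^ 2 + x 2 ^ 2 := by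
  simp [EuclideanSpace.norm_sq_eq, Fin.sum_univ_three]

theorem E3.ext_coord {x y : E3} (h0 : x 0 = y 0) (h1 : x 1 = y 1) (h2 : x 2 = y 2) : x = y := by
  ext i
  fin_cases i
  exacts [h0, h1, h2]

theorem det3_eq (a b c : E3) : det3 a b c =
    a 0 * b 1 * c 2 - a 0 * b 2 * c 1 - a 1 * b 0 * c 2 + a 1 * b 2 * c 0 + a 2 * b 0 * c 1 -
      a 2 * b 1 * c 0 := by
  simp [det3, Matrix.det_fin_three]

theorem quat_injective : Function.Injective quat := by
  intro x y h
  have h0 := congrArg QuaternionAlgebra.imI h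
  have h1 := congrArg QuaternionAlgebra.imJ h
  have h2 := congrArg QuaternionAlgebra.imK h
  exact E3.ext_coord h0 h1 h2

theorem quat_ne_zero {x : E3} (hx : x ≠ 0) : quat x ≠ 0 :=
  (map_ne_zero_iff quat quat_injective).2 hx

theorem star_quat (x : E3) : star (quat x) = -quat x := by
  ext <;> simp

theorem exists_quat_eq {z : ℍ[ℝ]} (hz : z.re = 0) : ∃ x : E3, quat x = z :=
  ⟨!₂[z.imI, z.imJ, z.imK], by ext <;> simp [hz]⟩

theorem quat_mul_self (x : E3) : quat x * quat x = ((-‖x‖ ^ 2 : ℝ) : ℍ[ℝ]) := by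
  rw [E3.norm_sq_eq]
  apply Quaternion.ext <;> simp [-Quaternion.coe_add, -Quaternion.coe_neg] <;> ring

theorem quat_sq_of_norm_eq_one {x : E3} (hx : ‖x‖ = 1) : quat x * quat x = -1 := by
  rw [quat_mul_self, hx]; simp

theorem norm_eq_one_iff_sq {x : E3} : ‖x‖ = 1 ↔ x 0 ^ 2 + x 1 ^ 2 + x 2 ^ 2 = 1 := by
  rw [← E3.norm_sq_eq, pow_eq_one_iff_of_nonneg (norm_nonneg x) two_ne_zero]

/-- The cross product of Euclidean three-space. -/
noncomputable def cross (x y : E3) : E3 := WithLp.toLp 2 (crossProduct x.ofLp y.ofLp)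

@[simp] theorem cross_zero_apply (x y : E3) : cross x y 0 = x 1 * y 2 - x 2 * y 1 := by
  simp [cross, cross_apply]
@[simp] theorem cross_one_apply (x y : E3) : cross x y 1 = x 2 * y 0 - x 0 * y 2 := by
  simp [cross, cross_apply]
@[simp] theorem cross_two_apply (x y : E3) : cross x y 2 = x 0 * y 1 - x 1 * y 0 := by
  simp [cross, cross_apply]

theorem quat_cross (x y : E3) :
    quat (cross x y) = -(quat y * quat x) - ((inner ℝ x y : ℝ) : ℍ[ℝ]) := by
  rw [E3.inner_eq]
  ext <;> simp <;> ring

theorem cross_smul_right (r : ℝ) (x y : E3) : cross x (r • y) = r • cross x y := by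
  apply E3.ext_coord <;> simp <;> ring

theorem continuous_quat : Continuous quat := quat.continuous_of_finiteDimensional

theorem continuous_cross : Continuous fun p : E3 × E3 => cross p.1 p.2 := by
  unfold cross
  refine (PiLp.continuous_toLp 2 _).comp ?_
  simp only [cross_apply]
  fun_prop

/-! ### The edge equation -/

/-- The edge condition of a parallel edge-constraint net as one quaternionic equation: the real
part says that `p' - p ⊥ m' + m`, the imaginary part that `p' - p` and `m' - m` are parallel. -/
def EdgeEq (p m p' m' : E3) : Prop :=
  quat m' * quat (p' - p) + quat (p' - p) * quat m = 0

theorem edgeEq_iff_coord {p m p' m' : E3} : EdgeEq p m p' m' ↔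
    inner ℝ (p' - p) (m' + m) = 0 ∧ cross (p' - p) (m' - m) = 0 := by
  unfold EdgeEq
  generalize p' - p = d
  rw [E3.inner_eq, Quaternion.ext_iff]
  constructor
  · rintro ⟨h, h0, h1, h2⟩
    simp at h h0 h1 h2
    refine ⟨by simp; linear_combination -h, ?_⟩
    apply E3.ext_coord <;> simp
    · linear_combination -h0
    · linear_combination -h1
    · linear_combination -h2
  · rintro ⟨h, h'⟩
    have h0 := congrArg (fun x : E3 => x 0) h'
    have h1 := congrArg (fun x : E3 => x 1) h'
    have h2 := congrArg (fun x : E3 => x 2) h'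
    simp at h h0 h1 h2
    refine ⟨?_, ?_, ?_, ?_⟩ <;> simp
    · linear_combination -h
    · linear_combination -h0
    · linear_combination -h1
    · linear_combination -h2

theorem exists_smul_of_cross_eq_zero {x y : E3} (hx : x ≠ 0) (h : cross x y = 0) :
    ∃ r : ℝ, y = r • x := by
  have hx' : ‖x‖ ^ 2 ≠ 0 := by simpa using hx
  have h0 := congrArg (fun x : E3 => x 0) h
  have h1 := congrArg (fun x : E3 => x 1) h
  have h2 := congrArg (fun x : E3 => x 2) h
  refine ⟨inner ℝ x y / ‖x‖ ^ 2, ?_⟩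
  rw [E3.norm_sq_eq] at *
  simp [E3.inner_eq] at h0 h1 h2 ⊢
  apply E3.ext_coord <;> simp <;> field_simp
  · linear_combination x 2 * h1 - x 1 * h2
  · linear_combination x 0 * h2 - x 2 * h0
  · linear_combination x 1 * h0 - x 0 * h1

theorem not_linearIndependent_pair_iff {x y : E3} :
    ¬ LinearIndependent ℝ ![x, y] ↔ cross x y = 0 := by
  by_cases hx : x = 0
  · subst hx
    refine iff_of_true (fun h => h.ne_zero 0 rfl) ?_
    apply E3.ext_coord <;> simp
  · rw [LinearIndependent.pair_iff' hx]
    push Not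
    constructor
    · rintro ⟨r, rfl⟩
      apply E3.ext_coord <;> simp <;> ring
    · intro h
      obtain ⟨r, hr⟩ := exists_smul_of_cross_eq_zero hx h
      exact ⟨r, hr.symm⟩

theorem edgeCond_iff_edgeEq {p m p' m' : E3} :
    GaussNet.EdgeCond p m p' m' ↔ EdgeEq p m p' m' := by
  rw [edgeEq_iff_coord, GaussNet.EdgeCond, not_linearIndependent_pair_iff]

theorem EdgeEq.symm {p m p' m' : E3} (h : EdgeEq p m p' m') : EdgeEq p' m' p m := by
  have h' := congrArg star h
  unfold EdgeEq
  rw [← neg_sub p' p, map_neg]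
  simp only [star_add, star_mul, star_quat, star_zero] at h'
  linear_combination (norm := noncomm_ring) -h'

theorem EdgeEq.smul {p m p' m' : E3} (h : EdgeEq p m p' m') (r : ℝ) :
    EdgeEq p (r • m) p' (r • m') := by
  unfold EdgeEq at *
  rw [map_smul, map_smul, smul_mul_assoc, mul_smul_comm, ← smul_add, h, smul_zero]

theorem EdgeEq.exists_smul {p m p' m' : E3} (h : EdgeEq p m p' m') (hp : p' - p ≠ 0) :
    ∃ r : ℝ, m' - m = r • (p' - p) :=
  exists_smul_of_cross_eq_zero hp (edgeEq_iff_coord.1 h).2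

/-! ### Transport along one edge -/

/-- The quaternion which transports `m` along the edge from `(p, n)` to `(p', n')`: a unit vector
`m'` continues `m` if and only if `m' A = -A m`, where `A` is this quaternion. -/
noncomputable def transport (p n p' n' m : E3) : ℍ[ℝ] :=
  quat (p' - p) + quat m * quat n - quat n' * quat m

/-- The edge vector of the transform with vertices `p + n × m`. The inner products `⟪n, m⟫`, which
are the real parts of `-(m n)`, cancel because they agree at both ends. -/
theorem quat_transform_sub {p n p' n' m m' : E3} (hc : inner ℝ n m = inner ℝ n' m') :
    quat (p' + cross n' m' - (p + cross n m)) =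
      quat (p' - p) - quat m' * quat n' + quat m * quat n := by
  simp only [map_sub, map_add, quat_cross, hc]
  abel

theorem edgeEq_transform_iff {p n p' n' m m' : E3} (hm : ‖m‖ = 1) (hm' : ‖m'‖ = 1)
    (hc : inner ℝ n m = inner ℝ n' m') :
    EdgeEq (p + cross n m) m (p' + cross n' m') m' ↔
      quat m' * transport p n p' n' m + transport p n p' n' m * quat m = 0 := by
  rw [EdgeEq, quat_transform_sub hc, transport,
    edge_transform_eq (quat_sq_of_norm_eq_one hm) (quat_sq_of_norm_eq_one hm')]

/-- Off resonance, the transport quaternion does not vanish. -/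
theorem transport_ne_zero {p n p' n' m : E3} {c : ℝ} (hn : ‖n‖ = 1) (hn' : ‖n'‖ = 1)
    (hm : ‖m‖ = 1) (hc : inner ℝ n m = c)
    (hres : ‖p' - p‖ ^ 2 + ‖n' - n‖ ^ 2 ≠ 4 * (1 - c ^ 2)) : transport p n p' n' m ≠ 0 := by
  intro h
  apply hres
  -- The real part of `A = 0` gives `⟪n', m⟫ = c`, the imaginary part `d = -m × (n + n')`.
  rw [transport, Quaternion.ext_iff] at h
  generalize p' - p = d at *
  obtain ⟨h, h0, h1, h2⟩ := h
  rw [norm_eq_one_iff_sq] at hn hn' hm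
  rw [E3.inner_eq] at hc
  simp at h h0 h1 h2
  simp only [E3.norm_sq_eq, PiLp.sub_apply]
  have e0 : d 0 = -(m 1 * (n 2 + n' 2) - m 2 * (n 1 + n' 1)) := by linear_combination h0
  have e1 : d 1 = -(m 2 * (n 0 + n' 0) - m 0 * (n 2 + n' 2)) := by linear_combination h1
  have e2 : d 2 = -(m 0 * (n 1 + n' 1) - m 1 * (n 0 + n' 0)) := by linear_combination h2
  have hc' : n' 0 * m 0 + n' 1 * m 1 + n' 2 * m 2 = c := by linear_combination h + hc
  rw [e0, e1, e2]
  linear_combination ((n 0 + n' 0) ^ 2 + (n 1 + n' 1) ^ 2 + (n 2 + n' 2) ^ 2) * hm + 2 * hn +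
    2 * hn' - (m 0 * (n 0 + n' 0) + m 1 * (n 1 + n' 1) + m 2 * (n 2 + n' 2) + 2 * c) * (hc + hc')

theorem inner_eq_of_quat {x y : E3} {c : ℝ} :
    quat x * quat y + quat y * quat x = ((-2 * c : ℝ) : ℍ[ℝ]) ↔ inner ℝ x y = c := by
  have key : quat x * quat y + quat y * quat x = ((-2 * inner ℝ x y : ℝ) : ℍ[ℝ]) := by
    rw [E3.inner_eq]; ext <;> simp <;> ring
  rw [key, Quaternion.coe_inj]
  constructor <;> intro h <;> linarith

/-- Off resonance, a transform given at one end of an edge continues uniquely to the other end. -/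
theorem existsUnique_transform_edge {p n p' n' m : E3} {c : ℝ} (hn : ‖n‖ = 1) (hn' : ‖n'‖ = 1)
    (hm : ‖m‖ = 1) (hc : inner ℝ n m = c) (h : EdgeEq p n p' n')
    (hres : ‖p' - p‖ ^ 2 + ‖n' - n‖ ^ 2 ≠ 4 * (1 - c ^ 2)) :
    ∃! m', (‖m'‖ = 1 ∧ inner ℝ n' m' = c) ∧
      EdgeEq (p + cross n m) m (p' + cross n' m') m' := by
  have hA := transport_ne_zero hn hn' hm hc hres
  have hAn := intertwine_normal (u := quat m) (quat_sq_of_norm_eq_one hn)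
    (quat_sq_of_norm_eq_one hn') h
  change quat n' * transport p n p' n' m = _ at hAn
  change _ = -(transport p n p' n' m * _) at hAn
  set A := transport p n p' n' m with hAdef
  -- The continuation is `-A m A⁻¹`, which is imaginary since `m` is.
  have hre : (-(A * quat m * A⁻¹)).re = 0 := by
    have : A⁻¹ = (normSq A)⁻¹ • star A := rfl
    rw [this]
    simp
    right
    ring
  obtain ⟨m', hm'⟩ := exists_quat_eq hre
  have hmA : quat m' * A = -(A * quat m) := by
    rw [hm', neg_mul, mul_assoc _ A⁻¹, inv_mul_cancel₀ hA, mul_one]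
  have hmm : quat m' * quat m' = -1 := by
    apply mul_right_cancel₀ hA
    linear_combination (norm := noncomm_ring) quat m' * hmA - hmA * quat m +
      A * quat_sq_of_norm_eq_one hm
  have hm1 : ‖m'‖ = 1 := by
    have := congrArg QuaternionAlgebra.re hmm
    rw [norm_eq_one_iff_sq]
    simp at this
    linear_combination -this
  have hc1 : inner ℝ n' m' = c := by
    rw [← inner_eq_of_quat]
    rw [← inner_eq_of_quat] at hc
    apply mul_right_cancel₀ hA
    have hcomm := Quaternion.coe_commutes (-2 * c) A
    linear_combination (norm := noncomm_ring) quat n' * hmA - hAn * quat m + quat m' * hAn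
      - hmA * quat n + A * hc - hcomm
  refine ⟨m', ⟨⟨hm1, hc1⟩, ?_⟩, ?_⟩
  · rw [edgeEq_transform_iff hm hm1 (hc.trans hc1.symm), ← hAdef, hmA, neg_add_cancel]
  · rintro m'' ⟨⟨hm2, hc2⟩, h2⟩
    rw [edgeEq_transform_iff hm hm2 (hc.trans hc2.symm), ← hAdef] at h2
    apply quat_injective
    apply mul_right_cancel₀ hA
    rw [hmA]
    exact eq_neg_of_add_eq_zero_left h2

/-! ### The face equation -/

/-- Equality of the coefficients of `t²` in the products of the Lax polynomials
`1 + t (p' - p) + t² n' n` along the two paths around a face. -/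
def FaceEq (p n p₁ n₁ p₂ n₂ p₁₂ n₁₂ : E3) : Prop :=
  quat n₁₂ * quat n₁ + quat n₁ * quat n + quat (p₁₂ - p₁) * quat (p₁ - p) =
    quat n₁₂ * quat n₂ + quat n₂ * quat n + quat (p₁₂ - p₂) * quat (p₂ - p)

theorem FaceEq.smul {p n p₁ n₁ p₂ n₂ p₁₂ n₁₂ : E3} (h : FaceEq p n p₁ n₁ p₂ n₂ p₁₂ n₁₂) {r : ℝ}
    (hr : r * r = 1) : FaceEq p (r • n) p₁ (r • n₁) p₂ (r • n₂) p₁₂ (r • n₁₂) := by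
  unfold FaceEq at *
  simpa only [map_smul, smul_mul_smul_comm, hr, one_smul] using h

/-- The face equation is inherited by a transform whose four edges satisfy the edge equation. -/
theorem FaceEq.transform {p n p₁ n₁ p₂ n₂ p₁₂ n₁₂ m m₁ m₂ m₁₂ : E3} {c : ℝ}
    (hn : ‖n‖ = 1) (hn₁ : ‖n₁‖ = 1) (hn₂ : ‖n₂‖ = 1)
    (hm₁ : ‖m₁‖ = 1) (hm₂ : ‖m₂‖ = 1) (hm₁₂ : ‖m₁₂‖ = 1)
    (hc : inner ℝ n m = c) (hc₁ : inner ℝ n₁ m₁ = c) (hc₂ : inner ℝ n₂ m₂ = c)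
    (hc₁₂ : inner ℝ n₁₂ m₁₂ = c)
    (e₁ : EdgeEq p n p₁ n₁) (e₂ : EdgeEq p n p₂ n₂)
    (e₂₁ : EdgeEq p₁ n₁ p₁₂ n₁₂) (e₁₂ : EdgeEq p₂ n₂ p₁₂ n₁₂)
    (d₁ : EdgeEq (p + cross n m) m (p₁ + cross n₁ m₁) m₁)
    (d₂ : EdgeEq (p + cross n m) m (p₂ + cross n₂ m₂) m₂)
    (d₂₁ : EdgeEq (p₁ + cross n₁ m₁) m₁ (p₁₂ + cross n₁₂ m₁₂) m₁₂)
    (d₁₂ : EdgeEq (p₂ + cross n₂ m₂) m₂ (p₁₂ + cross n₁₂ m₁₂) m₁₂)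
    (h : FaceEq p n p₁ n₁ p₂ n₂ p₁₂ n₁₂) :
    FaceEq (p + cross n m) m (p₁ + cross n₁ m₁) m₁ (p₂ + cross n₂ m₂) m₂
      (p₁₂ + cross n₁₂ m₁₂) m₁₂ := by
  have k₁ := lax_path (quat_sq_of_norm_eq_one hn) (quat_sq_of_norm_eq_one hn₁)
    (quat_sq_of_norm_eq_one hm₁) (quat_sq_of_norm_eq_one hm₁₂) e₁ e₂₁
    (quat_transform_sub (hc.trans hc₁.symm)) (quat_transform_sub (hc₁.trans hc₁₂.symm)) d₁ d₂₁
  have k₂ := lax_path (quat_sq_of_norm_eq_one hn) (quat_sq_of_norm_eq_one hn₂)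
    (quat_sq_of_norm_eq_one hm₂) (quat_sq_of_norm_eq_one hm₁₂) e₂ e₁₂
    (quat_transform_sub (hc.trans hc₂.symm)) (quat_transform_sub (hc₂.trans hc₁₂.symm)) d₂ d₁₂
  unfold FaceEq at *
  rw [k₁, k₂, h]
  simp only [← map_add, sub_add_sub_cancel]

/-- Off resonance, transport around a face with the face equation is consistent: if the two edges
from `p` through `p₁` to `p₁₂` and the edge from `p` to `p₂` satisfy the edge equation of the
transform, so does the last edge. -/
theorem FaceEq.transport_closes {p n p₁ n₁ p₂ n₂ p₁₂ n₁₂ m m₁ m₂ m₁₂ : E3} {c : ℝ}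
    (hn : ‖n‖ = 1) (hn₁ : ‖n₁‖ = 1) (hn₂ : ‖n₂‖ = 1) (hn₁₂ : ‖n₁₂‖ = 1)
    (hm : ‖m‖ = 1) (hm₁ : ‖m₁‖ = 1) (hm₂ : ‖m₂‖ = 1) (hm₁₂ : ‖m₁₂‖ = 1)
    (hc : inner ℝ n m = c) (hc₁ : inner ℝ n₁ m₁ = c) (hc₂ : inner ℝ n₂ m₂ = c)
    (hc₁₂ : inner ℝ n₁₂ m₁₂ = c)
    (e₁ : EdgeEq p n p₁ n₁) (e₂ : EdgeEq p n p₂ n₂)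
    (e₂₁ : EdgeEq p₁ n₁ p₁₂ n₁₂) (e₁₂ : EdgeEq p₂ n₂ p₁₂ n₁₂)
    (r₁ : ‖p₁ - p‖ ^ 2 + ‖n₁ - n‖ ^ 2 ≠ 4 * (1 - c ^ 2))
    (r₂₁ : ‖p₁₂ - p₁‖ ^ 2 + ‖n₁₂ - n₁‖ ^ 2 ≠ 4 * (1 - c ^ 2))
    (r₁₂ : ‖p₁₂ - p₂‖ ^ 2 + ‖n₁₂ - n₂‖ ^ 2 ≠ 4 * (1 - c ^ 2))
    (d₁ : EdgeEq (p + cross n m) m (p₁ + cross n₁ m₁) m₁)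
    (d₂ : EdgeEq (p + cross n m) m (p₂ + cross n₂ m₂) m₂)
    (d₂₁ : EdgeEq (p₁ + cross n₁ m₁) m₁ (p₁₂ + cross n₁₂ m₁₂) m₁₂)
    (h : FaceEq p n p₁ n₁ p₂ n₂ p₁₂ n₁₂) :
    EdgeEq (p₂ + cross n₂ m₂) m₂ (p₁₂ + cross n₁₂ m₁₂) m₁₂ := by
  obtain ⟨m', ⟨⟨hm', hc'⟩, d'⟩, -⟩ := existsUnique_transform_edge hn₂ hn₁₂ hm₂ hc₂ e₁₂ r₁₂
  suffices m₁₂ = m' by rwa [this]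
  have A₁ := transport_ne_zero hn hn₁ hm hc r₁
  have A₂₁ := transport_ne_zero hn₁ hn₁₂ hm₁ hc₁ r₂₁
  rw [edgeEq_transform_iff hm hm₁ (hc.trans hc₁.symm)] at d₁
  rw [edgeEq_transform_iff hm hm₂ (hc.trans hc₂.symm)] at d₂
  rw [edgeEq_transform_iff hm₁ hm₁₂ (hc₁.trans hc₁₂.symm)] at d₂₁
  rw [edgeEq_transform_iff hm₂ hm' (hc₂.trans hc'.symm)] at d'
  have k₁ := transport_path (quat_sq_of_norm_eq_one hn) (quat_sq_of_norm_eq_one hm)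
    (quat_sq_of_norm_eq_one hn₁) e₁ e₂₁ d₁
  have k₂ := transport_path (quat_sq_of_norm_eq_one hn) (quat_sq_of_norm_eq_one hm)
    (quat_sq_of_norm_eq_one hn₂) e₂ e₁₂ d₂
  unfold FaceEq at h
  have k : transport p₁ n₁ p₁₂ n₁₂ m₁ * transport p n p₁ n₁ m =
      transport p₂ n₂ p₁₂ n₁₂ m₂ * transport p n p₂ n₂ m := by
    unfold transport
    rw [k₁, k₂, h]
    simp only [← map_add, sub_add_sub_cancel]
  apply quat_injective
  apply mul_right_cancel₀ (mul_ne_zero A₂₁ A₁)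
  nth_rewrite 2 [k]
  linear_combination (norm := noncomm_ring) d₂₁ * transport p n p₁ n₁ m -
    transport p₁ n₁ p₁₂ n₁₂ m₁ * d₁ - d' * transport p n p₂ n₂ m +
    transport p₂ n₂ p₁₂ n₁₂ m₂ * d₂ + k * quat m

theorem FaceEq.det3_eq {p n p₁ n₁ p₂ n₂ p₁₂ n₁₂ : E3} (h : FaceEq p n p₁ n₁ p₂ n₂ p₁₂ n₁₂)
    (N : E3) : det3 (n₁₂ - n) (n₂ - n₁) N = -det3 (p₁₂ - p) (p₂ - p₁) N := by
  unfold FaceEq at h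
  rw [Quaternion.ext_iff] at h
  obtain ⟨-, h0, h1, h2⟩ := h
  simp at h0 h1 h2
  simp only [_root_.det3_eq, PiLp.sub_apply]
  linear_combination -N 0 * h0 - N 1 * h1 - N 2 * h2

/-- The product of two consecutive edge vectors intertwines the normals at the ends of the path. -/
theorem quat_path_comm {p n p₁ n₁ p₁₂ n₁₂ : E3} (e₁ : EdgeEq p n p₁ n₁)
    (e₂₁ : EdgeEq p₁ n₁ p₁₂ n₁₂) :
    quat n₁₂ * (quat (p₁₂ - p₁) * quat (p₁ - p)) = quat (p₁₂ - p₁) * quat (p₁ - p) * quat n := by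
  unfold EdgeEq at *
  linear_combination (norm := noncomm_ring) e₂₁ * quat (p₁ - p) - quat (p₁₂ - p₁) * e₁

/-- The imaginary part of the face equation implies the real part if `n₁₂ ≠ n`: the difference `E`
of the two sides satisfies `n₁₂ E = E n`, which forces `E = 0` if `E` is real. -/
theorem faceEq_of_cross {p n p₁ n₁ p₂ n₂ p₁₂ n₁₂ : E3} (hn : ‖n‖ = 1)
    (hn₁₂ : ‖n₁₂‖ = 1)
    (e₁ : EdgeEq p n p₁ n₁) (e₂ : EdgeEq p n p₂ n₂)
    (e₂₁ : EdgeEq p₁ n₁ p₁₂ n₁₂) (e₁₂ : EdgeEq p₂ n₂ p₁₂ n₁₂) (hne : n₁₂ ≠ n)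
    (h : cross (n₁₂ - n) (n₂ - n₁) = -cross (p₁₂ - p) (p₂ - p₁)) :
    FaceEq p n p₁ n₁ p₂ n₂ p₁₂ n₁₂ := by
  unfold FaceEq
  rw [← sub_eq_zero]
  set E := quat n₁₂ * quat n₁ + quat n₁ * quat n + quat (p₁₂ - p₁) * quat (p₁ - p) -
    (quat n₁₂ * quat n₂ + quat n₂ * quat n + quat (p₁₂ - p₂) * quat (p₂ - p)) with hE
  have hcomm : quat n₁₂ * E = E * quat n := by
    have hs := quat_sq_of_norm_eq_one hn
    have hs₁₂ := quat_sq_of_norm_eq_one hn₁₂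
    linear_combination (norm := noncomm_ring) quat_path_comm e₁ e₂₁ - quat_path_comm e₂ e₁₂ +
      hs₁₂ * quat n₁ - quat n₁ * hs - hs₁₂ * quat n₂ + quat n₂ * hs + quat n₁₂ * hE - hE * quat n
  have hre : E = ((E.re : ℝ) : ℍ[ℝ]) := by
    have h0 := congrArg (fun x : E3 => x 0) h
    have h1 := congrArg (fun x : E3 => x 1) h
    have h2 := congrArg (fun x : E3 => x 2) h
    simp at h0 h1 h2
    apply Quaternion.ext <;> simp [hE]
    · linear_combination -h0
    · linear_combination -h1
    · linear_combination -h2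
  by_contra hE0
  rw [hre, ← Quaternion.coe_commutes, ← hre] at hcomm
  exact hne (quat_injective (mul_left_cancel₀ hE0 hcomm))


theorem concyclic_or_collinear_triple (x y z : E3) :
    Concyclic ({x, y, z} : Set E3) ∨ Collinear ℝ ({x, y, z} : Set E3) := by
  by_cases hc : Collinear ℝ ({x, y, z} : Set E3)
  · exact Or.inr hc
  · rw [← affineIndependent_iff_not_collinear_set] at hc
    let s : Affine.Simplex ℝ E3 2 := ⟨![x, y, z], hc⟩
    refine Or.inl ⟨⟨s.circumcenter, s.circumradius, ?_⟩, coplanar_triple ℝ x y z⟩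
    rintro q (rfl | rfl | rfl)
    · exact s.dist_circumcenter_eq_circumradius 0
    · exact s.dist_circumcenter_eq_circumradius 1
    · exact s.dist_circumcenter_eq_circumradius 2

/-- Four points with real quaternionic cross-ratio lie on a circle or on a line. -/
theorem concyclic_or_collinear_of_mul_eq_smul {p p₁ p₂ p₁₂ : E3} {r : ℝ}
    (h₁ : p₁ ≠ p) (h₂₁ : p₁₂ ≠ p₁)
    (h : quat (p₁₂ - p₁) * quat (p₁ - p) = (r : ℍ[ℝ]) * (quat (p₁₂ - p₂) * quat (p₂ - p))) :
    Concyclic ({p, p₁, p₁₂, p₂} : Set E3) ∨ Collinear ℝ ({p, p₁, p₁₂, p₂} : Set E3) := by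
  have hr : r ≠ 0 := by
    rintro rfl
    rw [Quaternion.coe_zero, zero_mul] at h
    exact mul_ne_zero (quat_ne_zero (sub_ne_zero.2 h₂₁)) (quat_ne_zero (sub_ne_zero.2 h₁)) h
  by_cases he : p₁₂ = p
  · subst he
    have : ({p₁₂, p₁, p₁₂, p₂} : Set E3) = {p₁₂, p₁, p₂} := by
      ext; simp; tauto
    rw [this]
    exact concyclic_or_collinear_triple _ _ _
  obtain ⟨a, rfl⟩ : ∃ a, p₁ = p + a := ⟨p₁ - p, by abel⟩
  obtain ⟨e, rfl⟩ : ∃ e, p₁₂ = p + e := ⟨p₁₂ - p, by abel⟩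
  obtain ⟨c, rfl⟩ : ∃ c, p₂ = p + c := ⟨p₂ - p, by abel⟩
  have he : e ≠ 0 := by rintro rfl; simp at he
  have he2 : ‖e‖ ^ 2 ≠ 0 := by simpa using he
  set t : ℝ := (‖a‖ ^ 2 - r * ‖c‖ ^ 2) / ‖e‖ ^ 2 with ht
  have hte : t * ‖e‖ ^ 2 = ‖a‖ ^ 2 - r * ‖c‖ ^ 2 := by rw [ht]; field_simp
  -- The hypothesis amounts to `e (a - r c) = r ‖c‖² - ‖a‖²`, so `a - r c` is a multiple of `e`.
  have key : a - r • c = t • e := by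
    apply quat_injective
    apply mul_left_cancel₀ (quat_ne_zero he)
    rw [add_sub_add_left_eq_sub, add_sub_cancel_left, add_sub_add_left_eq_sub,
      add_sub_cancel_left, Quaternion.coe_mul_eq_smul] at h
    have ha := quat_mul_self a
    have hc := quat_mul_self c
    have hte' : (-‖a‖ ^ 2 : ℝ) - r * (-‖c‖ ^ 2) = t * (-‖e‖ ^ 2) := by linear_combination hte
    simp only [map_sub, map_smul, mul_sub, sub_mul, mul_smul_comm, smul_sub, quat_mul_self] at h ⊢
    have hte'' := congrArg (fun x : ℝ => (x : ℍ[ℝ])) hte'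
    simp only [Quaternion.coe_sub, Quaternion.coe_mul, Quaternion.coe_mul_eq_smul] at hte''
    rw [← hte'']
    rw [sub_eq_iff_eq_add] at h ⊢
    rw [h]
    abel
  have hc : c = r⁻¹ • a - (r⁻¹ * t) • e := by
    rw [mul_smul, ← key, smul_sub, smul_smul, inv_mul_cancel₀ hr, one_smul]; abel
  by_cases hcol : Collinear ℝ ({p, p + a, p + e} : Set E3)
  · right
    rw [collinear_iff_of_mem (p₀ := p) (by simp)] at hcol ⊢
    obtain ⟨v, hv⟩ := hcol
    obtain ⟨x, hx⟩ := hv (p + a) (by simp)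
    obtain ⟨y, hy⟩ := hv (p + e) (by simp)
    have hx : a = x • v := by simpa [add_comm] using hx
    have hy : e = y • v := by simpa [add_comm] using hy
    refine ⟨v, ?_⟩
    rintro q (rfl | rfl | rfl | rfl)
    · exact ⟨0, by simp⟩
    · exact ⟨x, by simp [hx, add_comm]⟩
    · exact ⟨y, by simp [hy, add_comm]⟩
    · exact ⟨r⁻¹ * x - r⁻¹ * t * y, by
        rw [hc, hx, hy, vadd_eq_add]; module⟩
  · left
    obtain ⟨⟨z, R, hz⟩, -⟩ := (concyclic_or_collinear_triple p (p + a) (p + e)).resolve_right hcol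
    refine ⟨⟨z, R, ?_⟩, ?_⟩
    · have h0 := hz p (by simp)
      have h1 := hz (p + a) (by simp)
      have h2 := hz (p + e) (by simp)
      rintro q (rfl | rfl | rfl | rfl)
      · exact h0
      · exact h1
      · exact h2
      · have hR : 0 ≤ R := h0 ▸ dist_nonneg
        rw [dist_eq_norm] at h0 h1 h2 ⊢
        rw [add_sub_right_comm] at h1 h2 ⊢
        generalize p - z = w at *
        have f1 := norm_add_sq_real w a
        have f2 := norm_add_sq_real w e
        have f3 := norm_add_sq_real w c
        have hwc : inner ℝ w c = r⁻¹ * inner ℝ w a - r⁻¹ * t * inner ℝ w e := by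
          rw [hc, inner_sub_right, inner_smul_right, inner_smul_right]
        have hcc : ‖c‖ ^ 2 = r⁻¹ * (‖a‖ ^ 2 - t * ‖e‖ ^ 2) := by
          rw [hte]; field_simp; ring
        rw [h0, h1] at f1
        rw [h0, h2] at f2
        rw [h0, hwc, hcc] at f3
        rw [← sq_eq_sq₀ (norm_nonneg _) hR]
        linear_combination f3 - r⁻¹ * f1 + r⁻¹ * t * f2
    · have hset : ({p, p + a, p + e, p + c} : Set E3) = insert (p + c) {p, p + a, p + e} := by
        ext; simp; tauto
      have hp : p ∈ affineSpan ℝ ({p, p + a, p + e} : Set E3) := mem_affineSpan ℝ (by simp)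
      have ha : a ∈ vectorSpan ℝ ({p, p + a, p + e} : Set E3) := by
        simpa using vsub_mem_vectorSpan ℝ (p₁ := p + a) (p₂ := p)
          (s := ({p, p + a, p + e} : Set E3)) (by simp) (by simp)
      have he : e ∈ vectorSpan ℝ ({p, p + a, p + e} : Set E3) := by
        simpa using vsub_mem_vectorSpan ℝ (p₁ := p + e) (p₂ := p)
          (s := ({p, p + a, p + e} : Set E3)) (by simp) (by simp)
      rw [hset, coplanar_insert_iff_of_mem_affineSpan]
      · exact coplanar_triple ℝ _ _ _
      · rw [add_comm p c]
        refine AffineSubspace.vadd_mem_of_mem_direction (v := c) ?_ hp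
        rw [direction_affineSpan, hc]
        exact sub_mem (Submodule.smul_mem _ _ ha) (Submodule.smul_mem _ _ he)


/-- The edge and face equations imply that the face is inscribed in a circle or a line. If no edge
vanishes, `n' - n = r (p' - p)` on each edge, and the face equation reads
`(1 + r₂₁ r₁) P = (1 + r₁₂ r₂) Q` for the products `P, Q` of consecutive edge vectors. This makes
the cross-ratio real unless both coefficients vanish. In that case the face is planar, and
`star Q * P` is real: it commutes with `n`, and its imaginary part is orthogonal to an edge to which
`n` is not orthogonal. -/
theorem FaceEq.concyclic_or_collinear {p n p₁ n₁ p₂ n₂ p₁₂ n₁₂ : E3} (hn : ‖n‖ = 1)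
    (hn₁ : ‖n₁‖ = 1)
    (e₁ : EdgeEq p n p₁ n₁) (e₂ : EdgeEq p n p₂ n₂)
    (e₂₁ : EdgeEq p₁ n₁ p₁₂ n₁₂) (e₁₂ : EdgeEq p₂ n₂ p₁₂ n₁₂) (hn₂ : ‖n₂‖ = 1)
    (h : FaceEq p n p₁ n₁ p₂ n₂ p₁₂ n₁₂) :
    Concyclic ({p, p₁, p₁₂, p₂} : Set E3) ∨ Collinear ℝ ({p, p₁, p₁₂, p₂} : Set E3) := by
  by_cases h₁ : p₁ = p
  · subst h₁
    simpa using concyclic_or_collinear_triple p₁ p₁₂ p₂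
  by_cases h₂₁ : p₁₂ = p₁
  · subst h₂₁
    simpa using concyclic_or_collinear_triple p p₁₂ p₂
  by_cases h₁₂ : p₁₂ = p₂
  · subst h₁₂
    simpa using concyclic_or_collinear_triple p p₁ p₁₂
  by_cases h₂ : p₂ = p
  · subst h₂
    have : ({p₂, p₁, p₁₂, p₂} : Set E3) = {p₂, p₁, p₁₂} := by
      ext; simp; tauto
    rw [this]
    exact concyclic_or_collinear_triple _ _ _
  obtain ⟨r₁, hr₁⟩ := e₁.exists_smul (sub_ne_zero.2 h₁)
  obtain ⟨r₂, hr₂⟩ := e₂.exists_smul (sub_ne_zero.2 h₂)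
  obtain ⟨r₂₁, hr₂₁⟩ := e₂₁.exists_smul (sub_ne_zero.2 h₂₁)
  obtain ⟨r₁₂, hr₁₂⟩ := e₁₂.exists_smul (sub_ne_zero.2 h₁₂)
  have hP := quat_path_comm e₁ e₂₁
  have hQ := quat_path_comm e₂ e₁₂
  have hQ0 : quat (p₁₂ - p₂) * quat (p₂ - p) ≠ 0 :=
    mul_ne_zero (quat_ne_zero (sub_ne_zero.2 h₁₂)) (quat_ne_zero (sub_ne_zero.2 h₂))
  have hlin : (1 + r₂₁ * r₁) • (quat (p₁₂ - p₁) * quat (p₁ - p)) =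
      (1 + r₁₂ * r₂) • (quat (p₁₂ - p₂) * quat (p₂ - p)) := by
    have f₁ : quat (n₁₂ - n₁) * quat (n₁ - n) =
        (r₂₁ * r₁) • (quat (p₁₂ - p₁) * quat (p₁ - p)) := by
      rw [hr₁, hr₂₁, map_smul, map_smul, smul_mul_smul_comm]
    have f₂ : quat (n₁₂ - n₂) * quat (n₂ - n) =
        (r₁₂ * r₂) • (quat (p₁₂ - p₂) * quat (p₂ - p)) := by
      rw [hr₂, hr₁₂, map_smul, map_smul, smul_mul_smul_comm]
    rw [add_smul, add_smul, one_smul, one_smul, ← f₁, ← f₂]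
    have s₁ := quat_sq_of_norm_eq_one hn₁
    have s₂ := quat_sq_of_norm_eq_one hn₂
    unfold FaceEq at h
    rw [map_sub quat n₁₂, map_sub quat n₁₂, map_sub quat n₁, map_sub quat n₂]
    linear_combination (norm := noncomm_ring) h - s₁ + s₂
  by_cases hc₁ : 1 + r₂₁ * r₁ = 0
  swap
  · apply concyclic_or_collinear_of_mul_eq_smul (r := (1 + r₂₁ * r₁)⁻¹ * (1 + r₁₂ * r₂)) h₁ h₂₁
    rw [Quaternion.coe_mul_eq_smul, mul_smul, ← hlin, smul_smul, inv_mul_cancel₀ hc₁, one_smul]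
  have hc₂ : 1 + r₁₂ * r₂ = 0 := by
    rw [hc₁, zero_smul] at hlin
    exact (smul_eq_zero.1 hlin.symm).resolve_right hQ0
  have hr₁0 : r₁ ≠ 0 := by rintro rfl; simp at hc₁
  set P := quat (p₁₂ - p₁) * quat (p₁ - p) with hPdef
  set Q := quat (p₁₂ - p₂) * quat (p₂ - p) with hQdef
  have hcomm : quat n * (star Q * P) = star Q * P * quat n := by
    have hQ' := congrArg star hQ
    rw [star_mul (quat n₁₂), star_mul Q, star_quat, star_quat] at hQ'
    linear_combination (norm := noncomm_ring) hQ' * P + star Q * hP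
  obtain ⟨a, rfl⟩ : ∃ a, p₁ = p + a := ⟨p₁ - p, by abel⟩
  obtain ⟨b, rfl⟩ : ∃ b, p₁₂ = p + a + b := ⟨p₁₂ - (p + a), by abel⟩
  obtain ⟨c, rfl⟩ : ∃ c, p₂ = p + c := ⟨p₂ - p, by abel⟩
  have ha : a ≠ 0 := by rintro rfl; simp at h₁
  rw [add_sub_cancel_left] at hr₁ hr₂ hr₂₁ hPdef hQdef
  have hd : p + a + b - (p + c) = a + b - c := by abel
  rw [hd] at hr₁₂ hQdef
  rw [add_sub_cancel_left] at hPdef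
  have hrel : r₁ • a + r₂₁ • b = r₂ • c + r₁₂ • (a + b - c) := by
    rw [← hr₁, ← hr₂, ← hr₂₁, ← hr₁₂]; abel
  -- A nonplanar face would make the ratios of all edges equal, contradicting `r₂₁ r₁ = -1`.
  have hdet : det3 a b c = 0 := by
    have g0 := congrArg (fun x : E3 => x 0) hrel
    have g1 := congrArg (fun x : E3 => x 1) hrel
    have g2 := congrArg (fun x : E3 => x 2) hrel
    simp at g0 g1 g2
    by_contra hdet
    have k₁ : r₁ = r₁₂ := by
      apply mul_right_cancel₀ hdet
      rw [_root_.det3_eq]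
      linear_combination (b 1 * c 2 - b 2 * c 1) * g0 + (b 2 * c 0 - b 0 * c 2) * g1 +
        (b 0 * c 1 - b 1 * c 0) * g2
    have k₂ : r₂₁ = r₁₂ := by
      apply mul_right_cancel₀ hdet
      rw [_root_.det3_eq]
      linear_combination (c 1 * a 2 - c 2 * a 1) * g0 + (c 2 * a 0 - c 0 * a 2) * g1 +
        (c 0 * a 1 - c 1 * a 0) * g2
    rw [k₁, k₂] at hc₁
    nlinarith [mul_self_nonneg r₁₂]
  -- As `n` and `n + r₁ a` are unit vectors, `n` is not orthogonal to `a`.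
  have hna : n 0 * a 0 + n 1 * a 1 + n 2 * a 2 ≠ 0 := by
    intro hna
    have hn₁' : n₁ = n + r₁ • a := by rw [← hr₁]; abel
    rw [norm_eq_one_iff_sq] at hn hn₁
    rw [hn₁'] at hn₁
    simp at hn₁
    have : r₁ ^ 2 * ‖a‖ ^ 2 = 0 := by
      rw [E3.norm_sq_eq]
      linear_combination hn₁ - hn - 2 * r₁ * hna
    simp [hr₁0, ha] at this
  have hag : a 0 * (star Q * P).imI + a 1 * (star Q * P).imJ + a 2 * (star Q * P).imK = 0 := by
    rw [_root_.det3_eq] at hdet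
    rw [hPdef, hQdef]
    simp
    linear_combination -(a 0 ^ 2 + a 1 ^ 2 + a 2 ^ 2) * hdet
  have hreal : star Q * P = ((star Q * P).re : ℍ[ℝ]) := by
    generalize star Q * P = G at *
    rw [Quaternion.ext_iff] at hcomm
    obtain ⟨-, g0, g1, g2⟩ := hcomm
    simp at g0 g1 g2
    apply Quaternion.ext
    · rfl
    all_goals
      apply mul_left_cancel₀ hna
      simp only [imI_coe, imJ_coe, imK_coe, mul_zero]
    · linear_combination n 0 * hag - a 1 / 2 * g2 + a 2 / 2 * g1
    · linear_combination n 1 * hag + a 0 / 2 * g2 - a 2 / 2 * g0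
    · linear_combination n 2 * hag - a 0 / 2 * g1 + a 1 / 2 * g0
  have hQn : ((normSq Q : ℝ) : ℍ[ℝ]) ≠ 0 := by
    rw [Ne, ← Quaternion.coe_zero, Quaternion.coe_inj]
    simpa using hQ0
  refine concyclic_or_collinear_of_mul_eq_smul (r := (normSq Q)⁻¹ * (star Q * P).re) h₁ h₂₁ ?_
  rw [add_sub_cancel_left (p + a) b, add_sub_cancel_left p a, hd, add_sub_cancel_left p c,
    ← hPdef, ← hQdef]
  apply mul_left_cancel₀ hQn
  rw [Quaternion.coe_mul, Quaternion.coe_inv, mul_assoc, mul_inv_cancel_left₀ hQn]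
  calc ((normSq Q : ℝ) : ℍ[ℝ]) * P = Q * (star Q * P) := by
        rw [← mul_assoc Q (star Q) P, Quaternion.self_mul_star]
    _ = Q * (((star Q * P).re : ℝ) : ℍ[ℝ]) := by rw [← hreal]
    _ = _ := (Quaternion.coe_commutes _ _).symm

/-! ### Nets with the edge and face equations -/

theorem exists_unit_orthogonal_of_coplanar {s : Set E3} (h : Coplanar ℝ s) :
    ∃ M : E3, ‖M‖ = 1 ∧ ∀ x ∈ s, ∀ y ∈ s, inner ℝ (x - y) M = 0 := by
  rw [coplanar_iff_finrank_le_two] at h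
  have hne : (vectorSpan ℝ s)ᗮ ≠ ⊥ := by
    rw [Ne, Submodule.orthogonal_eq_bot_iff]
    intro htop
    rw [htop, finrank_top] at h
    simp at h
  obtain ⟨v, hv, hv0⟩ := Submodule.exists_mem_ne_zero_of_ne_bot hne
  refine ⟨‖v‖⁻¹ • v, norm_smul_inv_norm hv0, fun x hx y hy => ?_⟩
  have := (Submodule.mem_orthogonal _ _).1 hv _ (vsub_mem_vectorSpan ℝ hx hy)
  rw [inner_smul_right, ← vsub_eq_sub, this, mul_zero]

theorem exists_unit_orthogonal_pair (u v : E3) :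
    ∃ M : E3, ‖M‖ = 1 ∧ inner ℝ u M = 0 ∧ inner ℝ v M = 0 := by
  obtain ⟨M, hM, h⟩ := exists_unit_orthogonal_of_coplanar (coplanar_triple ℝ 0 u v)
  exact ⟨M, hM, by simpa using h u (by simp) 0 (by simp), by simpa using h v (by simp) 0 (by simp)⟩

theorem cross_eq_det3_smul {x y M : E3} (hM : ‖M‖ = 1) (hx : inner ℝ x M = 0)
    (hy : inner ℝ y M = 0) : cross x y = det3 x y M • M := by
  rw [norm_eq_one_iff_sq] at hM
  rw [E3.inner_eq] at hx hy
  apply E3.ext_coord <;> simp [det3_eq]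
  · linear_combination -(x 1 * y 2 - x 2 * y 1) * hM - (M 2 * y 1 - M 1 * y 2) * hx -
      (M 1 * x 2 - M 2 * x 1) * hy
  · linear_combination -(x 2 * y 0 - x 0 * y 2) * hM - (M 0 * y 2 - M 2 * y 0) * hx -
      (M 2 * x 0 - M 0 * x 2) * hy
  · linear_combination -(x 0 * y 1 - x 1 * y 0) * hM - (M 1 * y 0 - M 0 * y 1) * hx -
      (M 0 * x 1 - M 1 * x 0) * hy

theorem EdgeEq.inner_eq_zero {p m p' m' M : E3} (h : EdgeEq p m p' m') (hp : p' ≠ p)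
    (hM : inner ℝ (p' - p) M = 0) : inner ℝ (m' - m) M = 0 := by
  obtain ⟨r, hr⟩ := h.exists_smul (sub_ne_zero.2 hp)
  rw [hr, inner_smul_left, hM, mul_zero]

namespace GaussNet

/-- The edge and face equations hold throughout the net: the Lax polynomials of the edges have
equal products along the two paths around each face. -/
structure IsLax (X : GaussNet) : Prop where
  edge₁ : ∀ k l, EdgeEq (X.f k l) (X.n k l) (X.f (k + 1) l) (X.n (k + 1) l)
  edge₂ : ∀ k l, EdgeEq (X.f k l) (X.n k l) (X.f k (l + 1)) (X.n k (l + 1))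
  face : ∀ k l, FaceEq (X.f k l) (X.n k l) (X.f (k + 1) l) (X.n (k + 1) l)
    (X.f k (l + 1)) (X.n k (l + 1)) (X.f (k + 1) (l + 1)) (X.n (k + 1) (l + 1))

theorem IsLax.isCKNet {X : GaussNet} (h : X.IsLax) : X.IsCKNet where
  parallel k l := ⟨edgeCond_iff_edgeEq.2 (h.edge₁ k l), edgeCond_iff_edgeEq.2 (h.edge₂ k l)⟩
  circular k l := (h.face k l).concyclic_or_collinear (X.norm_n _ _) (X.norm_n _ _)
    (h.edge₁ k l) (h.edge₂ k l) (h.edge₂ _ _) (h.edge₁ _ _) (X.norm_n _ _)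
  curvature k l N _ := by
    rw [neg_one_mul]
    exact (h.face k l).det3_eq N

/-- A nondegenerate cK-net satisfies the face equations. On a nondegenerate face at most one edge
vanishes, so the plane of the face is also parallel to the quadrilateral of the normals, and the
curvature condition becomes an equation between cross products. -/
theorem IsCKNet.isLax {X : GaussNet} (hX : X.IsCKNet) (hreg : X.IsNondegenerate) : X.IsLax := by
  have E₁ k l := edgeCond_iff_edgeEq.1 (hX.parallel k l).1
  have E₂ k l := edgeCond_iff_edgeEq.1 (hX.parallel k l).2
  refine ⟨E₁, E₂, fun k l => ?_⟩
  have e₁ := E₁ k l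
  have e₂ := E₂ k l
  have e₂₁ := E₂ (k + 1) l
  have e₁₂ := E₁ k (l + 1)
  have hcirc := hX.circular k l
  have hcurv := hX.curvature k l
  have hdet := hreg k l
  have hn := X.norm_n k l
  have hn₁₂ := X.norm_n (k + 1) (l + 1)
  unfold detF detN IsFaceNormal at *
  generalize X.f k l = p, X.n k l = n, X.f (k + 1) l = p₁, X.n (k + 1) l = n₁,
    X.f k (l + 1) = p₂, X.n k (l + 1) = n₂, X.f (k + 1) (l + 1) = p₁₂,
    X.n (k + 1) (l + 1) = n₁₂ at *
  have hcop : Coplanar ℝ ({p, p₁, p₁₂, p₂} : Set E3) :=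
    hcirc.elim (fun h => h.2) (fun h => h.coplanar)
  obtain ⟨N, hN⟩ := exists_unit_orthogonal_pair (n₁₂ - n) (n₂ - n₁)
  have hdiag := hdet N hN
  have hcN := hcurv N hN
  have hne : n₁₂ ≠ n := by
    rintro rfl
    rw [neg_one_mul, eq_neg_iff_add_eq_zero] at hcN
    apply hdiag
    rw [← hcN]
    simp [det3_eq]
  obtain ⟨M, hM, horth⟩ := exists_unit_orthogonal_of_coplanar hcop
  have o₁ := horth p₁ (by simp) p (by simp)
  have o₂ := horth p₂ (by simp) p (by simp)
  have o₂₁ := horth p₁₂ (by simp) p₁ (by simp)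
  have o₁₂ := horth p₁₂ (by simp) p₂ (by simp)
  have i₁ := fun h => EdgeEq.inner_eq_zero e₁ h o₁
  have i₂ := fun h => EdgeEq.inner_eq_zero e₂ h o₂
  have i₂₁ := fun h => EdgeEq.inner_eq_zero e₂₁ h o₂₁
  have i₁₂ := fun h => EdgeEq.inner_eq_zero e₁₂ h o₁₂
  simp only [inner_sub_left] at i₁ i₂ i₂₁ i₁₂
  -- Any three of the four differences of normals determine the diagonals.
  have hMn : inner ℝ (n₁₂ - n) M = 0 ∧ inner ℝ (n₂ - n₁) M = 0 := by
    simp only [inner_sub_left]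
    simp only [_root_.det3_eq, PiLp.sub_apply] at hdiag
    by_cases h₁ : p₁ = p
    · have := i₂ (by rintro rfl; subst h₁; simp at hdiag)
      have := i₂₁ (by rintro rfl; subst h₁; simp at hdiag)
      have := i₁₂ (by rintro rfl; subst h₁; apply hdiag; ring)
      constructor <;> linarith
    by_cases h₂ : p₂ = p
    · have := i₁ h₁
      have := i₂₁ (by rintro rfl; subst h₂; apply hdiag; ring)
      have := i₁₂ (by rintro rfl; subst h₂; simp at hdiag)
      constructor <;> linarith
    by_cases h₂₁ : p₁₂ = p₁
    · have := i₁ h₁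
      have := i₂ h₂
      have := i₁₂ (by rintro rfl; subst h₂₁; simp at hdiag)
      constructor <;> linarith
    · have := i₁ h₁
      have := i₂ h₂
      have := i₂₁ h₂₁
      constructor <;> linarith
  have hMp : inner ℝ (p₁₂ - p) M = 0 ∧ inner ℝ (p₂ - p₁) M = 0 :=
    ⟨horth _ (by simp) _ (by simp), horth _ (by simp) _ (by simp)⟩
  apply faceEq_of_cross hn hn₁₂ e₁ e₂ e₂₁ e₁₂ hne
  rw [cross_eq_det3_smul hM hMn.1 hMn.2, cross_eq_det3_smul hM hMp.1 hMp.2,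
    hcurv M ⟨hM, hMn⟩, neg_one_mul, neg_smul]

end GaussNet

/-! ### Sections over the integer lattice -/

theorem exists_int_seq {α : Type*} (S : ℤ → Set α) (r : ℤ → α → α → Prop)
    (fwd : ∀ k, ∀ x ∈ S k, ∃ y ∈ S (k + 1), r k x y)
    (bwd : ∀ k, ∀ y ∈ S (k + 1), ∃ x ∈ S k, r k x y) (k₀ : ℤ) {x₀ : α} (hx₀ : x₀ ∈ S k₀) :
    ∃ u : ℤ → α, (∀ k, u k ∈ S k) ∧ (∀ k, r k (u k) (u (k + 1))) ∧ u k₀ = x₀ := by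
  have bwd' : ∀ k, ∀ y : S k, ∃ x : S (k - 1), r (k - 1) x y := by
    rintro k ⟨y, hy⟩
    obtain ⟨x, hx, h⟩ := bwd (k - 1) y (by rwa [sub_add_cancel])
    exact ⟨⟨x, hx⟩, h⟩
  have fwd' : ∀ k, ∀ x : S k, ∃ y : S (k + 1), r k x y := by
    rintro k ⟨x, hx⟩
    obtain ⟨y, hy, h⟩ := fwd k x hx
    exact ⟨⟨y, hy⟩, h⟩
  choose F hF using fwd'
  choose B hB using bwd'
  let u : ∀ k, S k := fun k =>
    Int.inductionOn' (motive := fun k => S k) k k₀ ⟨x₀, hx₀⟩ (fun k _ => F k) (fun k _ => B k)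
  refine ⟨fun k => u k, fun k => (u k).2, fun k => ?_, ?_⟩
  · rcases le_or_gt k₀ k with h | h
    · have : u (k + 1) = F k (u k) := Int.inductionOn'_add_one h
      beta_reduce
      rw [this]
      exact hF k (u k)
    · obtain ⟨j, rfl⟩ : ∃ j, k = j - 1 := ⟨k + 1, by ring⟩
      have : u (j - 1) = B j (u j) := Int.inductionOn'_sub_one (by omega)
      have h' : ((u (j - 1 + 1) : S _) : α) = u j :=
        congrArg (fun i => ((u i : S i) : α)) (sub_add_cancel j 1)
      beta_reduce
      rw [this, h']
      exact hB j (u j)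
  · have : u k₀ = ⟨x₀, hx₀⟩ := Int.inductionOn'_self
    beta_reduce
    rw [this]

theorem Int.forall_of_iff_succ {p : ℤ → Prop} (k₀ : ℤ) (h₀ : p k₀) (h : ∀ k, p k ↔ p (k + 1))
    (k : ℤ) : p k := by
  induction k using Int.inductionOn' (b := k₀) with
  | zero => exact h₀
  | succ k _ hk => exact (h k).1 hk
  | pred k _ hk =>
    rw [h, sub_add_cancel]
    exact hk

/-- A value at one vertex extends to the whole lattice if it can be continued along each edge in
both directions and continuation closes up around each square. -/
theorem exists_int_lattice_section {α : Type*} (S : ℤ → ℤ → Set α) (r₁ r₂ : ℤ → ℤ → α → α → Prop)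
    (fwd₁ : ∀ k l, ∀ x ∈ S k l, ∃ y ∈ S (k + 1) l, r₁ k l x y)
    (bwd₁ : ∀ k l, ∀ y ∈ S (k + 1) l, ∃ x ∈ S k l, r₁ k l x y)
    (fwd₂ : ∀ k l, ∀ x ∈ S k l, ∃ y ∈ S k (l + 1), r₂ k l x y)
    (bwd₂ : ∀ k l, ∀ y ∈ S k (l + 1), ∃ x ∈ S k l, r₂ k l x y)
    (sq : ∀ k l, ∀ x ∈ S k l, ∀ x₁ ∈ S (k + 1) l, ∀ x₂ ∈ S k (l + 1), ∀ x₁₂ ∈ S (k + 1) (l + 1),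
      r₂ k l x x₂ → r₂ (k + 1) l x₁ x₁₂ → (r₁ k l x x₁ ↔ r₁ k (l + 1) x₂ x₁₂))
    (k₀ l₀ : ℤ) {x₀ : α} (hx₀ : x₀ ∈ S k₀ l₀) :
    ∃ u : ℤ → ℤ → α, (∀ k l, u k l ∈ S k l) ∧ (∀ k l, r₁ k l (u k l) (u (k + 1) l)) ∧
      (∀ k l, r₂ k l (u k l) (u k (l + 1))) ∧ u k₀ l₀ = x₀ := by
  obtain ⟨v, hvS, hvr, hv₀⟩ := exists_int_seq (fun k => S k l₀) (fun k => r₁ k l₀)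
    (fun k => fwd₁ k l₀) (fun k => bwd₁ k l₀) k₀ hx₀
  have col := fun k => exists_int_seq (fun l => S k l) (fun l => r₂ k l)
    (fun l => fwd₂ k l) (fun l => bwd₂ k l) l₀ (hvS k)
  choose u huS hur hu₀ using col
  refine ⟨u, huS, fun k l => ?_, hur, (hu₀ k₀).trans hv₀⟩
  refine Int.forall_of_iff_succ (p := fun l => r₁ k l (u k l) (u (k + 1) l)) l₀ ?_ (fun l => ?_) l
  · rw [hu₀, hu₀]
    exact hvr k
  · exact sq k l _ (huS _ _) _ (huS _ _) _ (huS _ _) _ (huS _ _) (hur _ _) (hur _ _)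

/-! ### Bäcklund fields -/

namespace GaussNet

/-- `m` is a field of unit normals with `⟪n, m⟫ = c` for which the net with vertices `f + n × m`
and normals `m` satisfies the edge equations. The parameter is `c = sign α * cos α`; the sign of `α`
is absorbed in `m = sign α • ñ`. -/
structure IsBacklundField (X : GaussNet) (c : ℝ) (m : ℤ → ℤ → E3) : Prop where
  norm_eq_one : ∀ k l, ‖m k l‖ = 1
  inner_eq : ∀ k l, inner ℝ (X.n k l) (m k l) = c
  edge₁ : ∀ k l, EdgeEq (X.f k l + cross (X.n k l) (m k l)) (m k l)
    (X.f (k + 1) l + cross (X.n (k + 1) l) (m (k + 1) l)) (m (k + 1) l)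
  edge₂ : ∀ k l, EdgeEq (X.f k l + cross (X.n k l) (m k l)) (m k l)
    (X.f k (l + 1) + cross (X.n k (l + 1)) (m k (l + 1))) (m k (l + 1))

/-- The net with vertices `f + n × m` and normals `m`. -/
noncomputable def transform (X : GaussNet) (m : ℤ → ℤ → E3) (hm : ∀ k l, ‖m k l‖ = 1) :
    GaussNet where
  f k l := X.f k l + cross (X.n k l) (m k l)
  n := m
  norm_n := hm

theorem IsBacklundField.isLax {X : GaussNet} (hX : X.IsLax) {c : ℝ} {m : ℤ → ℤ → E3}
    (h : X.IsBacklundField c m) : (X.transform m h.norm_eq_one).IsLax where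
  edge₁ := h.edge₁
  edge₂ := h.edge₂
  face k l := (hX.face k l).transform (X.norm_n _ _) (X.norm_n _ _) (X.norm_n _ _)
    (h.norm_eq_one _ _) (h.norm_eq_one _ _) (h.norm_eq_one _ _)
    (h.inner_eq _ _) (h.inner_eq _ _) (h.inner_eq _ _) (h.inner_eq _ _)
    (hX.edge₁ _ _) (hX.edge₂ _ _) (hX.edge₂ _ _) (hX.edge₁ _ _)
    (h.edge₁ _ _) (h.edge₂ _ _) (h.edge₂ _ _) (h.edge₁ _ _)

/-- Non-resonance in terms of `c = ± cos α`, so that `1 - c² = sin² α`. -/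
def IsNonresonantCos (X : GaussNet) (c : ℝ) : Prop :=
  ∀ k l,
    ‖X.f (k + 1) l - X.f k l‖ ^ 2 + ‖X.n (k + 1) l - X.n k l‖ ^ 2 ≠ 4 * (1 - c ^ 2) ∧
    ‖X.f k (l + 1) - X.f k l‖ ^ 2 + ‖X.n k (l + 1) - X.n k l‖ ^ 2 ≠ 4 * (1 - c ^ 2)

/-- Unique continuation along an edge in the backward direction. -/
theorem _root_.existsUnique_transform_edge_symm {p n p' n' m : E3} {c : ℝ} (hn : ‖n‖ = 1)
    (hn' : ‖n'‖ = 1) (hm : ‖m‖ = 1) (hc : inner ℝ n' m = c) (h : EdgeEq p n p' n')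
    (hres : ‖p' - p‖ ^ 2 + ‖n' - n‖ ^ 2 ≠ 4 * (1 - c ^ 2)) :
    ∃! m', (‖m'‖ = 1 ∧ inner ℝ n m' = c) ∧
      EdgeEq (p + cross n m') m' (p' + cross n' m) m := by
  rw [norm_sub_rev p', norm_sub_rev n'] at hres
  obtain ⟨m', ⟨h₁, h₂⟩, hu⟩ := existsUnique_transform_edge hn' hn hm hc h.symm hres
  exact ⟨m', ⟨h₁, h₂.symm⟩, fun y hy => hu y ⟨hy.1, hy.2.symm⟩⟩

/-- Off resonance, a Bäcklund field is determined by its value at one vertex. -/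
theorem IsBacklundField.eq_of_eq {X : GaussNet} (hX : X.IsLax) {c : ℝ}
    (hres : X.IsNonresonantCos c) {m m' : ℤ → ℤ → E3}
    (h : X.IsBacklundField c m) (h' : X.IsBacklundField c m') {k₀ l₀ : ℤ}
    (h₀ : m k₀ l₀ = m' k₀ l₀) : m = m' := by
  have row : ∀ k, m k l₀ = m' k l₀ := by
    refine Int.forall_of_iff_succ k₀ h₀ fun k => ⟨fun hk => ?_, fun hk => ?_⟩
    · have e := h'.edge₁ k l₀
      rw [← hk] at e
      exact (existsUnique_transform_edge (X.norm_n _ _) (X.norm_n _ _) (h.norm_eq_one _ _)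
        (h.inner_eq _ _) (hX.edge₁ k l₀) (hres k l₀).1).unique
        ⟨⟨h.norm_eq_one _ _, h.inner_eq _ _⟩, h.edge₁ _ _⟩
        ⟨⟨h'.norm_eq_one _ _, h'.inner_eq _ _⟩, e⟩
    · have e := h'.edge₁ k l₀
      rw [← hk] at e
      exact (existsUnique_transform_edge_symm (X.norm_n _ _) (X.norm_n _ _) (h.norm_eq_one _ _)
        (h.inner_eq _ _) (hX.edge₁ k l₀) (hres k l₀).1).unique
        ⟨⟨h.norm_eq_one _ _, h.inner_eq _ _⟩, h.edge₁ _ _⟩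
        ⟨⟨h'.norm_eq_one _ _, h'.inner_eq _ _⟩, e⟩
  funext k
  funext l
  revert l
  refine Int.forall_of_iff_succ l₀ (row k) fun l => ⟨fun hk => ?_, fun hk => ?_⟩
  · have e := h'.edge₂ k l
    rw [← hk] at e
    exact (existsUnique_transform_edge (X.norm_n _ _) (X.norm_n _ _) (h.norm_eq_one _ _)
      (h.inner_eq _ _) (hX.edge₂ k l) (hres k l).2).unique
      ⟨⟨h.norm_eq_one _ _, h.inner_eq _ _⟩, h.edge₂ _ _⟩
      ⟨⟨h'.norm_eq_one _ _, h'.inner_eq _ _⟩, e⟩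
  · have e := h'.edge₂ k l
    rw [← hk] at e
    exact (existsUnique_transform_edge_symm (X.norm_n _ _) (X.norm_n _ _) (h.norm_eq_one _ _)
      (h.inner_eq _ _) (hX.edge₂ k l) (hres k l).2).unique
      ⟨⟨h.norm_eq_one _ _, h.inner_eq _ _⟩, h.edge₂ _ _⟩
      ⟨⟨h'.norm_eq_one _ _, h'.inner_eq _ _⟩, e⟩

theorem transport_square_iff {X : GaussNet} (hX : X.IsLax) {c : ℝ} (hres : X.IsNonresonantCos c)
    {k l : ℤ} {m m₁ m₂ m₁₂ : E3} (hm : ‖m‖ = 1 ∧ inner ℝ (X.n k l) m = c)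
    (hm₁ : ‖m₁‖ = 1 ∧ inner ℝ (X.n (k + 1) l) m₁ = c)
    (hm₂ : ‖m₂‖ = 1 ∧ inner ℝ (X.n k (l + 1)) m₂ = c)
    (hm₁₂ : ‖m₁₂‖ = 1 ∧ inner ℝ (X.n (k + 1) (l + 1)) m₁₂ = c)
    (d₂ : EdgeEq (X.f k l + cross (X.n k l) m) m
      (X.f k (l + 1) + cross (X.n k (l + 1)) m₂) m₂)
    (d₂₁ : EdgeEq (X.f (k + 1) l + cross (X.n (k + 1) l) m₁) m₁
      (X.f (k + 1) (l + 1) + cross (X.n (k + 1) (l + 1)) m₁₂) m₁₂) :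
    EdgeEq (X.f k l + cross (X.n k l) m) m (X.f (k + 1) l + cross (X.n (k + 1) l) m₁) m₁ ↔
      EdgeEq (X.f k (l + 1) + cross (X.n k (l + 1)) m₂) m₂
        (X.f (k + 1) (l + 1) + cross (X.n (k + 1) (l + 1)) m₁₂) m₁₂ := by
  have closes : ∀ m₁ m₁₂ : E3, (‖m₁‖ = 1 ∧ inner ℝ (X.n (k + 1) l) m₁ = c) →
      (‖m₁₂‖ = 1 ∧ inner ℝ (X.n (k + 1) (l + 1)) m₁₂ = c) →
      EdgeEq (X.f k l + cross (X.n k l) m) m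
        (X.f (k + 1) l + cross (X.n (k + 1) l) m₁) m₁ →
      EdgeEq (X.f (k + 1) l + cross (X.n (k + 1) l) m₁) m₁
        (X.f (k + 1) (l + 1) + cross (X.n (k + 1) (l + 1)) m₁₂) m₁₂ →
      EdgeEq (X.f k (l + 1) + cross (X.n k (l + 1)) m₂) m₂
        (X.f (k + 1) (l + 1) + cross (X.n (k + 1) (l + 1)) m₁₂) m₁₂ := by
    intro m₁ m₁₂ hm₁ hm₁₂ d₁ d₂₁
    exact (hX.face k l).transport_closes (X.norm_n _ _) (X.norm_n _ _) (X.norm_n _ _)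
      (X.norm_n _ _) hm.1 hm₁.1 hm₂.1 hm₁₂.1 hm.2 hm₁.2 hm₂.2 hm₁₂.2
      (hX.edge₁ _ _) (hX.edge₂ _ _) (hX.edge₂ _ _) (hX.edge₁ _ _)
      (hres _ _).1 (hres _ _).2 (hres _ _).1 d₁ d₂ d₂₁
  refine ⟨fun d₁ => closes m₁ m₁₂ hm₁ hm₁₂ d₁ d₂₁, fun d₁₂ => ?_⟩
  obtain ⟨m', ⟨hm', d'⟩, -⟩ := existsUnique_transform_edge (X.norm_n _ _) (X.norm_n _ _) hm.1 hm.2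
    (hX.edge₁ k l) (hres k l).1
  obtain ⟨m'', ⟨hm'', d''⟩, -⟩ := existsUnique_transform_edge (X.norm_n _ _) (X.norm_n _ _)
    hm'.1 hm'.2 (hX.edge₂ (k + 1) l) (hres (k + 1) l).2
  have e₁₂ : m'' = m₁₂ := (existsUnique_transform_edge (X.norm_n _ _) (X.norm_n _ _) hm₂.1 hm₂.2
    (hX.edge₁ k (l + 1)) (hres _ _).1).unique ⟨hm'', closes m' m'' hm' hm'' d' d''⟩ ⟨hm₁₂, d₁₂⟩
  subst e₁₂
  have e₁ : m' = m₁ := (existsUnique_transform_edge_symm (X.norm_n _ _) (X.norm_n _ _)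
    hm''.1 hm''.2 (hX.edge₂ (k + 1) l) (hres _ _).2).unique ⟨hm', d''⟩ ⟨hm₁, d₂₁⟩
  rwa [← e₁]

theorem exists_isBacklundField_of_nonresonant {X : GaussNet} (hX : X.IsLax) {c : ℝ}
    (hres : X.IsNonresonantCos c) (k₀ l₀ : ℤ) {μ : E3} (hμ : ‖μ‖ = 1)
    (hc : inner ℝ (X.n k₀ l₀) μ = c) :
    ∃ m, X.IsBacklundField c m ∧ m k₀ l₀ = μ := by
  obtain ⟨m, hmS, h₁, h₂, h₀⟩ := exists_int_lattice_section
    (fun k l => {m : E3 | ‖m‖ = 1 ∧ inner ℝ (X.n k l) m = c})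
    (fun k l m m' => EdgeEq (X.f k l + cross (X.n k l) m) m
      (X.f (k + 1) l + cross (X.n (k + 1) l) m') m')
    (fun k l m m' => EdgeEq (X.f k l + cross (X.n k l) m) m
      (X.f k (l + 1) + cross (X.n k (l + 1)) m') m')
    (fun k l m hm => (existsUnique_transform_edge (X.norm_n _ _) (X.norm_n _ _) hm.1 hm.2
      (hX.edge₁ k l) (hres k l).1).exists)
    (fun k l m hm => (existsUnique_transform_edge_symm (X.norm_n _ _) (X.norm_n _ _) hm.1 hm.2
      (hX.edge₁ k l) (hres k l).1).exists)
    (fun k l m hm => (existsUnique_transform_edge (X.norm_n _ _) (X.norm_n _ _) hm.1 hm.2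
      (hX.edge₂ k l) (hres k l).2).exists)
    (fun k l m hm => (existsUnique_transform_edge_symm (X.norm_n _ _) (X.norm_n _ _) hm.1 hm.2
      (hX.edge₂ k l) (hres k l).2).exists)
    (fun k l _ hm _ hm₁ _ hm₂ _ hm₁₂ => transport_square_iff hX hres hm hm₁ hm₂ hm₁₂) k₀ l₀ ⟨hμ, hc⟩
  exact ⟨m, ⟨fun k l => (hmS k l).1, fun k l => (hmS k l).2, h₁, h₂⟩, h₀⟩
end GaussNet

/-! ### Existence for resonant parameters -/

@[fun_prop]
theorem Continuous.quat {T : Type*} [TopologicalSpace T] {g : T → E3} (hg : Continuous g) :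
    Continuous fun t => quat (g t) :=
  continuous_quat.comp hg

@[fun_prop]
theorem Continuous.cross {T : Type*} [TopologicalSpace T] {g h : T → E3} (hg : Continuous g)
    (hh : Continuous h) : Continuous fun t => cross (g t) (h t) :=
  continuous_cross.comp (hg.prodMk hh)

theorem isClosed_setOf_edgeEq {T : Type*} [TopologicalSpace T] {p m p' m' : T → E3}
    (hp : Continuous p) (hm : Continuous m) (hp' : Continuous p') (hm' : Continuous m') :
    IsClosed {t | EdgeEq (p t) (m t) (p' t) (m' t)} := by
  unfold EdgeEq
  exact isClosed_eq (by fun_prop) continuous_const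

namespace GaussNet

theorem isClosed_setOf_isBacklundField (X : GaussNet) :
    IsClosed {q : ℝ × (ℤ → ℤ → E3) | X.IsBacklundField q.1 q.2} := by
  have hc : ∀ k l, Continuous fun q : ℝ × (ℤ → ℤ → E3) => q.2 k l := fun k l => by fun_prop
  have : {q : ℝ × (ℤ → ℤ → E3) | X.IsBacklundField q.1 q.2} = ⋂ k, ⋂ l,
      ({q | ‖q.2 k l‖ = 1} ∩ {q | inner ℝ (X.n k l) (q.2 k l) = q.1}) ∩
      ({q | EdgeEq (X.f k l + _root_.cross (X.n k l) (q.2 k l)) (q.2 k l)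
        (X.f (k + 1) l + _root_.cross (X.n (k + 1) l) (q.2 (k + 1) l)) (q.2 (k + 1) l)} ∩
      {q | EdgeEq (X.f k l + _root_.cross (X.n k l) (q.2 k l)) (q.2 k l)
        (X.f k (l + 1) + _root_.cross (X.n k (l + 1)) (q.2 k (l + 1))) (q.2 k (l + 1))}) := by
    ext q
    simp only [Set.mem_iInter, Set.mem_inter_iff, Set.mem_ofPred_eq]
    exact ⟨fun h k l => ⟨⟨h.1 k l, h.2 k l⟩, h.3 k l, h.4 k l⟩, fun h =>
      ⟨fun k l => (h k l).1.1, fun k l => (h k l).1.2, fun k l => (h k l).2.1,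
        fun k l => (h k l).2.2⟩⟩
  rw [this]
  refine isClosed_iInter fun k => isClosed_iInter fun l => ?_
  have h₀ := hc k l
  have h₁ := hc (k + 1) l
  have h₂ := hc k (l + 1)
  refine ((isClosed_eq (by fun_prop) (by fun_prop)).inter
    (isClosed_eq (by fun_prop) (by fun_prop))).inter
    ((isClosed_setOf_edgeEq ?_ ?_ ?_ ?_).inter (isClosed_setOf_edgeEq ?_ ?_ ?_ ?_)) <;> fun_prop

theorem countable_not_isNonresonantCos (X : GaussNet) :
    {c : ℝ | ¬ X.IsNonresonantCos c}.Countable := by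
  have hroot : ∀ s : ℝ, {c : ℝ | s = 4 * (1 - c ^ 2)}.Countable := by
    intro s
    refine (Set.toFinite {√(1 - s / 4), -√(1 - s / 4)}).countable.mono fun c hc => ?_
    have hc : s = 4 * (1 - c ^ 2) := hc
    have : √(1 - s / 4) = |c| := by
      rw [← Real.sqrt_sq_eq_abs, hc]
      congr 1
      ring
    rw [this]
    rcases abs_choice c with h | h <;> rw [h] <;> simp
  refine (Set.countable_iUnion fun k => Set.countable_iUnion fun l =>
    (hroot (‖X.f (k + 1) l - X.f k l‖ ^ 2 + ‖X.n (k + 1) l - X.n k l‖ ^ 2)).union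
      (hroot (‖X.f k (l + 1) - X.f k l‖ ^ 2 + ‖X.n k (l + 1) - X.n k l‖ ^ 2))).mono ?_
  intro c hc
  by_contra h
  simp only [Set.mem_iUnion, not_exists, Set.mem_union, not_or, Set.mem_ofPred_eq] at h
  exact hc h

/-- A Bäcklund field with given value at one vertex exists for all `c ∈ (-1, 1)`. The parameters
`d` for which there is a field with the value `ν d`, a continuous family through `μ`, form a closed
set by compactness, and this set contains the dense set of non-resonant parameters. -/
theorem exists_isBacklundField {X : GaussNet} (hX : X.IsLax) {c : ℝ}
    (hc : c ∈ Set.Ioo (-1 : ℝ) 1) (k₀ l₀ : ℤ) {μ : E3} (hμ : ‖μ‖ = 1)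
    (hμc : inner ℝ (X.n k₀ l₀) μ = c) :
    ∃ m, X.IsBacklundField c m ∧ m k₀ l₀ = μ := by
  set n := X.n k₀ l₀ with hn
  have hn1 : ‖n‖ = 1 := X.norm_n _ _
  have hnn : inner ℝ n n = (1 : ℝ) := by rw [real_inner_self_eq_norm_sq, hn1, one_pow]
  have hpos : 0 < 1 - c ^ 2 := by nlinarith [hc.1, hc.2]
  have hs : √(1 - c ^ 2) ≠ 0 := (Real.sqrt_pos.2 hpos).ne'
  let ν : ℝ → E3 := fun d => d • n + (√(1 - d ^ 2) / √(1 - c ^ 2)) • (μ - c • n)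
  have hνcont : Continuous ν := by fun_prop
  have hν : ν c = μ := by simp [ν, div_self hs]
  have hort : inner ℝ n (μ - c • n) = 0 := by
    rw [inner_sub_right, inner_smul_right, hμc, hnn]; ring
  have hνinner : ∀ d, inner ℝ n (ν d) = d := by
    intro d
    simp only [ν]
    rw [inner_add_right, inner_smul_right, inner_smul_right, hort, hnn]; ring
  have hνnorm : ∀ d ∈ Set.Ioo (-1 : ℝ) 1, ‖ν d‖ = 1 := by
    intro d hd
    have hd' : 0 ≤ 1 - d ^ 2 := by nlinarith [hd.1, hd.2]
    have h1 : ‖μ - c • n‖ ^ 2 = 1 - c ^ 2 := by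
      rw [norm_sub_sq_real, norm_smul, inner_smul_right, real_inner_comm, hμc, hμ, hn1,
        Real.norm_eq_abs, mul_one, sq_abs]
      ring
    have h2 : ‖ν d‖ ^ 2 = 1 := by
      simp only [ν]
      rw [norm_add_sq_real, norm_smul, norm_smul, inner_smul_left, inner_smul_right, hort, hn1,
        Real.norm_eq_abs, Real.norm_eq_abs, mul_one, sq_abs, mul_pow, sq_abs, h1, div_pow,
        Real.sq_sqrt hpos.le, Real.sq_sqrt hd', div_mul_cancel₀ _ hpos.ne']
      simp
    exact (pow_eq_one_iff_of_nonneg (norm_nonneg _) two_ne_zero).1 h2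
  let K : Set (ℝ × (ℤ → ℤ → E3)) :=
    {q | X.IsBacklundField q.1 q.2} ∩ {q | q.2 k₀ l₀ = ν q.1} ∩
      Set.Icc (-1 : ℝ) 1 ×ˢ Set.univ.pi fun _ => Set.univ.pi fun _ => Metric.sphere (0 : E3) 1
  have hK : IsCompact K := by
    refine IsCompact.inter_left ?_ ?_
    · exact isCompact_Icc.prod
        (isCompact_univ_pi fun _ => isCompact_univ_pi fun _ => isCompact_sphere _ _)
    · exact X.isClosed_setOf_isBacklundField.inter (isClosed_eq (by fun_prop) (by fun_prop))
  have hclosed : IsClosed (Prod.fst '' K) := (hK.image continuous_fst).isClosed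
  have hdense : Dense {d : ℝ | ¬ X.IsNonresonantCos d}ᶜ :=
    X.countable_not_isNonresonantCos.dense_compl ℝ
  have hmem : c ∈ closure (Set.Ioo (-1 : ℝ) 1 ∩ {d : ℝ | ¬ X.IsNonresonantCos d}ᶜ) :=
    hdense.open_subset_closure_inter isOpen_Ioo hc
  have hsub : Set.Ioo (-1 : ℝ) 1 ∩ {d : ℝ | ¬ X.IsNonresonantCos d}ᶜ ⊆ Prod.fst '' K := by
    rintro d ⟨hd, hdres⟩
    obtain ⟨m, hm, hm₀⟩ := exists_isBacklundField_of_nonresonant hX (not_not.1 hdres) k₀ l₀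
      (hνnorm d hd) (hνinner d)
    refine ⟨(d, m), ⟨⟨hm, hm₀⟩, Set.Ioo_subset_Icc_self hd, fun k _ l _ => ?_⟩, rfl⟩
    simpa using hm.norm_eq_one k l
  obtain ⟨⟨d, m⟩, ⟨⟨hm, hm₀⟩, -⟩, rfl⟩ := closure_minimal hsub hclosed hmem
  exact ⟨m, hm, hm₀.trans hν⟩

end GaussNet

/-! ### Permutability of Bäcklund fields -/

/-- The reflection of `n` in the plane orthogonal to `u - v` completes `n, u, v` to the normals of
a Bianchi quadrilateral. -/
theorem exists_permutability {n u v : E3} (hn : ‖n‖ = 1) (hu : ‖u‖ = 1) (hv : ‖v‖ = 1)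
    (huv : u ≠ v) : ∃ w : E3, ‖w‖ = 1 ∧ inner ℝ u w = (inner ℝ n v : ℝ) ∧
      inner ℝ v w = (inner ℝ n u : ℝ) ∧
      quat w * (quat u - quat v) = -((quat u - quat v) * quat n) := by
  have hB : ‖u - v‖ ^ 2 ≠ 0 := by simpa [sub_eq_zero] using huv
  have hB' := norm_sub_sq_real u v
  rw [hu, hv] at hB'
  have huu : inner ℝ u u = (1 : ℝ) := by rw [real_inner_self_eq_norm_sq, hu, one_pow]
  have hvv : inner ℝ v v = (1 : ℝ) := by rw [real_inner_self_eq_norm_sq, hv, one_pow]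
  obtain ⟨t, ht⟩ : ∃ t, t = 2 * inner ℝ n (u - v) / ‖u - v‖ ^ 2 := ⟨_, rfl⟩
  have ht' : t * ‖u - v‖ ^ 2 = 2 * inner ℝ n (u - v) := by
    rw [ht, div_mul_cancel₀ _ hB]
  have hnB : inner ℝ n (u - v) = (inner ℝ n u - inner ℝ n v : ℝ) := inner_sub_right _ _ _
  refine ⟨n - t • (u - v), ?_, ?_, ?_, ?_⟩
  · rw [← pow_eq_one_iff_of_nonneg (norm_nonneg _) two_ne_zero, norm_sub_sq_real, norm_smul,
      inner_smul_right, hn, mul_pow, Real.norm_eq_abs, sq_abs]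
    linear_combination t * ht'
  · rw [inner_sub_right, inner_smul_right, inner_sub_right, huu, real_inner_comm]
    linear_combination -ht' / 2 + t / 2 * hB' - hnB
  · rw [inner_sub_right, inner_smul_right, inner_sub_right, hvv, real_inner_comm n v,
      real_inner_comm u v]
    linear_combination ht' / 2 - t / 2 * hB' + hnB
  · have k₁ := inner_eq_of_quat.2 (rfl : inner ℝ n (u - v) = (inner ℝ n (u - v) : ℝ))
    have k₂ := quat_mul_self (u - v)
    have k₃ : t • (quat (u - v) * quat (u - v)) =
        quat n * quat (u - v) + quat (u - v) * quat n := by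
      rw [k₁, k₂, ← Quaternion.coe_mul_eq_smul, ← Quaternion.coe_mul, Quaternion.coe_inj]
      linear_combination -ht'
    rw [← map_sub, map_sub quat n, map_smul, sub_mul, smul_mul_assoc, k₃]
    abel

/-- The two paths of a Bianchi quadrilateral lead to the same point if and only if
`w (u - v) = -(u - v) n`; this determines `w` if `u ≠ v`. -/
theorem cross_add_cross_eq {n u v w : E3}
    (hu : inner ℝ u w = (inner ℝ n v : ℝ)) (hv : inner ℝ v w = (inner ℝ n u : ℝ)) :
    cross n u + cross u w = cross n v + cross v w ↔
      quat w * (quat u - quat v) = -((quat u - quat v) * quat n) := by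
  rw [← quat_injective.eq_iff, map_add, map_add, quat_cross, quat_cross, quat_cross, quat_cross,
    hu, hv, ← sub_eq_zero, ← add_eq_zero_iff_eq_neg, ← neg_eq_zero]
  have : -(-(quat u * quat n) - ((inner ℝ n u : ℝ) : ℍ[ℝ]) +
      (-(quat w * quat u) - ((inner ℝ n v : ℝ) : ℍ[ℝ])) -
      (-(quat v * quat n) - ((inner ℝ n v : ℝ) : ℍ[ℝ]) +
      (-(quat w * quat v) - ((inner ℝ n u : ℝ) : ℍ[ℝ])))) =
      quat w * (quat u - quat v) + (quat u - quat v) * quat n := by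
    noncomm_ring
  rw [this]

theorem EdgeEq.permutability {p n p' n' u u' v v' w w' : E3} {c d : ℝ}
    (hn : ‖n‖ = 1) (hn' : ‖n'‖ = 1) (hu : ‖u‖ = 1) (hu' : ‖u'‖ = 1)
    (hv : ‖v‖ = 1) (hv' : ‖v'‖ = 1) (hw : ‖w‖ = 1) (hw' : ‖w'‖ = 1)
    (hc : inner ℝ n u = c) (hc' : inner ℝ n' u' = c)
    (hd : inner ℝ n v = d) (hd' : inner ℝ n' v' = d)
    (huw : inner ℝ u w = d) (huw' : inner ℝ u' w' = d) (huv : u ≠ v)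
    (e : EdgeEq p n p' n')
    (eu : EdgeEq (p + cross n u) u (p' + cross n' u') u')
    (ev : EdgeEq (p + cross n v) v (p' + cross n' v') v')
    (hB : quat w * (quat u - quat v) = -((quat u - quat v) * quat n))
    (hB' : quat w' * (quat u' - quat v') = -((quat u' - quat v') * quat n')) :
    EdgeEq (p + cross n u + cross u w) w (p' + cross n' u' + cross u' w') w' := by
  rw [edgeEq_transform_iff hu hu' (hc.trans hc'.symm)] at eu
  rw [edgeEq_transform_iff hv hv' (hd.trans hd'.symm)] at ev
  rw [edgeEq_transform_iff hw hw' (huw.trans huw'.symm)]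
  have key := permutability_edge (quat_sq_of_norm_eq_one hu) (quat_sq_of_norm_eq_one hv) eu ev hB
  rw [← quat_transform_sub (hc.trans hc'.symm)] at key
  change transport (p + cross n u) u (p' + cross n' u') u' w * _ =
    -(_ * transport p n p' n' v) at key
  have hCn : quat n' * transport p n p' n' v = -(transport p n p' n' v * quat n) :=
    intertwine_normal (quat_sq_of_norm_eq_one hn) (quat_sq_of_norm_eq_one hn') e
  have hBne : quat u - quat v ≠ 0 := sub_ne_zero.2 (quat_injective.ne huv)
  apply mul_right_cancel₀ hBne
  rw [zero_mul]
  generalize transport (p + cross n u) u (p' + cross n' u') u' w = T at *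
  generalize transport p n p' n' v = C at *
  generalize quat u - quat v = B at *
  generalize quat u' - quat v' = B' at *
  linear_combination (norm := noncomm_ring) quat w' * key - hB' * C + B' * hCn + T * hB -
    key * quat n

namespace GaussNet

theorem IsBacklundField.permutability {X : GaussNet} (hX : X.IsLax) {c d : ℝ}
    {u v w : ℤ → ℤ → E3} (hu : X.IsBacklundField c u) (hv : X.IsBacklundField d v)
    (huv : ∀ k l, u k l ≠ v k l) (hw : ∀ k l, ‖w k l‖ = 1)
    (huw : ∀ k l, inner ℝ (u k l) (w k l) = d)
    (hB : ∀ k l, quat (w k l) * (quat (u k l) - quat (v k l)) =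
      -((quat (u k l) - quat (v k l)) * quat (X.n k l))) :
    (X.transform u hu.norm_eq_one).IsBacklundField d w where
  norm_eq_one := hw
  inner_eq := huw
  edge₁ k l := (hX.edge₁ k l).permutability (X.norm_n _ _) (X.norm_n _ _)
    (hu.norm_eq_one _ _) (hu.norm_eq_one _ _) (hv.norm_eq_one _ _) (hv.norm_eq_one _ _)
    (hw _ _) (hw _ _) (hu.inner_eq _ _) (hu.inner_eq _ _) (hv.inner_eq _ _) (hv.inner_eq _ _)
    (huw _ _) (huw _ _) (huv _ _) (hu.edge₁ k l) (hv.edge₁ k l) (hB _ _) (hB _ _)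
  edge₂ k l := (hX.edge₂ k l).permutability (X.norm_n _ _) (X.norm_n _ _)
    (hu.norm_eq_one _ _) (hu.norm_eq_one _ _) (hv.norm_eq_one _ _) (hv.norm_eq_one _ _)
    (hw _ _) (hw _ _) (hu.inner_eq _ _) (hu.inner_eq _ _) (hv.inner_eq _ _) (hv.inner_eq _ _)
    (huw _ _) (huw _ _) (huv _ _) (hu.edge₂ k l) (hv.edge₂ k l) (hB _ _) (hB _ _)

end GaussNet

/-! ### Bäcklund transforms of nets -/

theorem realSign_mul_self {α : ℝ} (hα : α ≠ 0) : Real.sign α * Real.sign α = 1 := by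
  rcases Real.sign_apply_eq_of_ne_zero α hα with h | h <;> simp [h]

theorem realSign_mul_eq_abs {α : ℝ} (hα : α ≠ 0) : Real.sign α * α = |α| := by
  rcases hα.lt_or_gt with h | h
  · rw [Real.sign_of_neg h, abs_of_neg h, neg_one_mul]
  · rw [Real.sign_of_pos h, abs_of_pos h, one_mul]

theorem sin_ne_zero_of_neg_pi_lt_of_lt_pi {α : ℝ} (h₁ : -Real.pi < α) (h₂ : α < Real.pi)
    (h₀ : α ≠ 0) : Real.sin α ≠ 0 := by
  rcases h₀.lt_or_gt with h | h
  · exact (Real.sin_neg_of_neg_of_neg_pi_lt h h₁).ne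
  · exact (Real.sin_pos_of_pos_of_lt_pi h h₂).ne'

theorem angle_eq_abs_iff {α : ℝ} (h₁ : -Real.pi < α) (h₂ : α < Real.pi) {n m : E3}
    (hn : ‖n‖ = 1) (hm : ‖m‖ = 1) :
    InnerProductGeometry.angle n m = |α| ↔ inner ℝ n m = Real.cos α := by
  rw [InnerProductGeometry.inner_eq_cos_angle_of_norm_eq_one hn hm, ← Real.cos_abs α]
  have hα : |α| ≤ Real.pi := (abs_lt.2 ⟨h₁, h₂⟩).le
  exact (Real.injOn_cos.eq_iff ⟨InnerProductGeometry.angle_nonneg _ _,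
    InnerProductGeometry.angle_le_pi _ _⟩ ⟨abs_nonneg α, hα⟩).symm

/-- At a vertex, the conditions of a Bäcklund transformation say that the connecting vector `d` is
`sign α • (n × m)` and that `⟪n, m⟫ = cos α`. -/
theorem backlund_vertex_iff {α : ℝ} (h₁ : -Real.pi < α) (h₂ : α < Real.pi) (h₀ : α ≠ 0)
    {n m d : E3} (hn : ‖n‖ = 1) (hm : ‖m‖ = 1) :
    (‖d‖ = |Real.sin α| ∧ inner ℝ d n = (0 : ℝ) ∧ inner ℝ d m = (0 : ℝ) ∧
      InnerProductGeometry.angle n m = |α| ∧ 0 < α * det3 n m d) ↔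
    inner ℝ n (Real.sign α • m) = Real.sign α * Real.cos α ∧ d = cross n (Real.sign α • m) := by
  have hs := realSign_mul_self h₀
  have hs0 : Real.sign α ≠ 0 := left_ne_zero_of_mul_eq_one hs
  have hsin := sin_ne_zero_of_neg_pi_lt_of_lt_pi h₁ h₂ h₀
  have hsc := Real.sin_sq_add_cos_sq α
  rw [angle_eq_abs_iff h₁ h₂ hn hm, inner_smul_right, cross_smul_right, mul_right_inj' hs0]
  have hn' := norm_eq_one_iff_sq.1 hn
  have hm' := norm_eq_one_iff_sq.1 hm
  have hdist : ‖d‖ = |Real.sin α| ↔ d 0 ^ 2 + d 1 ^ 2 + d 2 ^ 2 = Real.sin α ^ 2 := by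
    rw [← E3.norm_sq_eq, ← sq_abs (Real.sin α), sq_eq_sq₀ (norm_nonneg _) (abs_nonneg _)]
  rw [hdist]
  simp only [E3.inner_eq, det3_eq]
  set s := Real.sign α
  have hsα : s * α = |α| := realSign_mul_eq_abs h₀
  have hcross : n 0 * m 0 + n 1 * m 1 + n 2 * m 2 = Real.cos α →
      (n 1 * m 2 - n 2 * m 1) ^ 2 + (n 2 * m 0 - n 0 * m 2) ^ 2 + (n 0 * m 1 - n 1 * m 0) ^ 2 =
        Real.sin α ^ 2 := fun hc => by
    linear_combination (m 0 ^ 2 + m 1 ^ 2 + m 2 ^ 2) * hn' + hm' -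
      (n 0 * m 0 + n 1 * m 1 + n 2 * m 2 + Real.cos α) * hc - hsc
  constructor
  · rintro ⟨hd, hdn, hdm, hc, hpos⟩
    refine ⟨hc, ?_⟩
    have hv := hcross hc
    obtain ⟨δ, hδ⟩ : ∃ δ, n 0 * m 1 * d 2 - n 0 * m 2 * d 1 - n 1 * m 0 * d 2 + n 1 * m 2 * d 0 +
      n 2 * m 0 * d 1 - n 2 * m 1 * d 0 = δ := ⟨_, rfl⟩
    rw [hδ] at hpos
    -- `d` is parallel to `n × m`, so `δ = ⟪d, n × m⟫` satisfies `δ² = ‖d‖² ‖n × m‖²`.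
    have hx₀ : d 1 * (n 0 * m 1 - n 1 * m 0) - d 2 * (n 2 * m 0 - n 0 * m 2) = 0 := by
      linear_combination n 0 * hdm - m 0 * hdn
    have hx₁ : d 2 * (n 1 * m 2 - n 2 * m 1) - d 0 * (n 0 * m 1 - n 1 * m 0) = 0 := by
      linear_combination n 1 * hdm - m 1 * hdn
    have hx₂ : d 0 * (n 2 * m 0 - n 0 * m 2) - d 1 * (n 1 * m 2 - n 2 * m 1) = 0 := by
      linear_combination n 2 * hdm - m 2 * hdn
    have hδ2 : δ ^ 2 = (Real.sin α ^ 2) ^ 2 := by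
      rw [← hδ]
      linear_combination ((n 1 * m 2 - n 2 * m 1) ^ 2 + (n 2 * m 0 - n 0 * m 2) ^ 2 +
        (n 0 * m 1 - n 1 * m 0) ^ 2) * hd + Real.sin α ^ 2 * hv -
        (d 1 * (n 0 * m 1 - n 1 * m 0) - d 2 * (n 2 * m 0 - n 0 * m 2)) * hx₀ -
        (d 2 * (n 1 * m 2 - n 2 * m 1) - d 0 * (n 0 * m 1 - n 1 * m 0)) * hx₁ -
        (d 0 * (n 2 * m 0 - n 0 * m 2) - d 1 * (n 1 * m 2 - n 2 * m 1)) * hx₂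
    have hsδ_pos : 0 < s * δ := by
      refine pos_of_mul_pos_right (a := |α|) ?_ (abs_nonneg α)
      rw [← hsα]
      linear_combination hpos - α * δ * hs
    have hsδ : s * δ = Real.sin α ^ 2 := by
      rw [← sq_eq_sq₀ hsδ_pos.le (sq_nonneg _)]
      linear_combination hδ2 + δ ^ 2 * hs
    have hzero : ‖d - s • cross n m‖ ^ 2 = 0 := by
      rw [E3.norm_sq_eq]
      simp
      linear_combination hd - 2 * s * hδ - 2 * hsδ + s ^ 2 * hv + Real.sin α ^ 2 * hs
    exact sub_eq_zero.1 (norm_eq_zero.1 (pow_eq_zero_iff two_ne_zero |>.1 hzero))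
  · rintro ⟨hc, rfl⟩
    have hv := hcross hc
    simp
    refine ⟨?_, ?_, ?_, hc, ?_⟩
    · linear_combination s ^ 2 * hv + Real.sin α ^ 2 * hs
    · ring
    · ring
    · have : 0 < |α| * Real.sin α ^ 2 := by positivity
      rw [← hsα, ← hv] at this
      linear_combination this

theorem cross_smul_right_eq_left (r : ℝ) (x y : E3) : cross x (r • y) = cross (r • x) y := by
  apply E3.ext_coord <;> simp <;> ring

theorem inner_smul_right_eq_left (r : ℝ) (x y : E3) :
    inner ℝ x (r • y) = (inner ℝ (r • x) y : ℝ) := by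
  rw [real_inner_smul_left, real_inner_smul_right]

namespace GaussNet

theorem isBacklund_iff {α : ℝ} (h₁ : -Real.pi < α) (h₂ : α < Real.pi) (h₀ : α ≠ 0)
    {X Y : GaussNet} : IsBacklund α X Y ↔ ∀ k l,
      inner ℝ (X.n k l) (Real.sign α • Y.n k l) = Real.sign α * Real.cos α ∧
      Y.f k l = X.f k l + cross (X.n k l) (Real.sign α • Y.n k l) := by
  have key := fun k l => backlund_vertex_iff h₁ h₂ h₀ (X.norm_n k l) (Y.norm_n k l)
    (d := Y.f k l - X.f k l)
  simp only [sub_eq_iff_eq_add'] at key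
  constructor
  · exact fun h k l => (key k l).1 ⟨h.dist k l, h.orth k l, h.orth' k l, h.angle k l, h.sign k l⟩
  · intro h
    have h := fun k l => (key k l).2 (h k l)
    exact ⟨fun k l => (h k l).1, fun k l => (h k l).2.1, fun k l => (h k l).2.2.1,
      fun k l => (h k l).2.2.2.1, fun k l => (h k l).2.2.2.2⟩

theorem norm_sign_smul {α : ℝ} (h₀ : α ≠ 0) {x : E3} (hx : ‖x‖ = 1) : ‖Real.sign α • x‖ = 1 := by
  rw [norm_smul, hx, mul_one, Real.norm_eq_abs]
  rcases Real.sign_apply_eq_of_ne_zero α h₀ with h | h <;> simp [h]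

theorem sign_smul_sign_smul {α : ℝ} (h₀ : α ≠ 0) (x : E3) :
    Real.sign α • Real.sign α • x = x := by
  rw [smul_smul, realSign_mul_self h₀, one_smul]

/-- The net with its normals multiplied by the sign of `α`. -/
noncomputable def signSMul (X : GaussNet) (α : ℝ) (h₀ : α ≠ 0) : GaussNet where
  f := X.f
  n k l := Real.sign α • X.n k l
  norm_n k l := norm_sign_smul h₀ (X.norm_n k l)

theorem IsLax.signSMul {X : GaussNet} (h : X.IsLax) {α : ℝ} (h₀ : α ≠ 0) :
    (X.signSMul α h₀).IsLax where
  edge₁ k l := (h.edge₁ k l).smul _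
  edge₂ k l := (h.edge₂ k l).smul _
  face k l := (h.face k l).smul (realSign_mul_self h₀)

theorem IsBacklund.isBacklundField {α : ℝ} (h₁ : -Real.pi < α) (h₂ : α < Real.pi) (h₀ : α ≠ 0)
    {X Y : GaussNet} (h : IsBacklund α X Y) (hY : Y.IsCKNet) :
    X.IsBacklundField (Real.sign α * Real.cos α) fun k l => Real.sign α • Y.n k l := by
  rw [isBacklund_iff h₁ h₂ h₀] at h
  refine ⟨fun k l => norm_sign_smul h₀ (Y.norm_n k l), fun k l => (h k l).1, fun k l => ?_,
    fun k l => ?_⟩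
  · rw [← (h k l).2, ← (h (k + 1) l).2]
    exact (edgeCond_iff_edgeEq.1 (hY.parallel k l).1).smul _
  · rw [← (h k l).2, ← (h k (l + 1)).2]
    exact (edgeCond_iff_edgeEq.1 (hY.parallel k l).2).smul _

theorem isNonresonantCos_iff {X : GaussNet} {α : ℝ} (h₀ : α ≠ 0) :
    X.IsNonresonantCos (Real.sign α * Real.cos α) ↔ X.IsNonresonant α := by
  have : 4 * (1 - (Real.sign α * Real.cos α) ^ 2) = 4 * Real.sin α ^ 2 := by
    rw [mul_pow, sq (Real.sign α), realSign_mul_self h₀, Real.sin_sq]; ring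
  unfold IsNonresonantCos IsNonresonant
  rw [this]

theorem sign_mul_cos_mem_Ioo {α : ℝ} (h₁ : -Real.pi < α) (h₂ : α < Real.pi) (h₀ : α ≠ 0) :
    Real.sign α * Real.cos α ∈ Set.Ioo (-1 : ℝ) 1 := by
  have hs := realSign_mul_self h₀
  have hsin := sq_pos_of_ne_zero (sin_ne_zero_of_neg_pi_lt_of_lt_pi h₁ h₂ h₀)
  rw [Set.mem_Ioo, ← abs_lt, ← sq_lt_one_iff_abs_lt_one, mul_pow, sq (Real.sign α), hs]
  linarith [Real.sin_sq_add_cos_sq α]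

theorem backlund_unique {X : GaussNet} (hX : X.IsLax) {α : ℝ} (h₁ : -Real.pi < α)
    (h₂ : α < Real.pi) (h₀ : α ≠ 0) (hres : X.IsNonresonant α) {Y Y' : GaussNet}
    (hY : Y.IsCKNet) (hB : IsBacklund α X Y) (hY' : Y'.IsCKNet) (hB' : IsBacklund α X Y')
    {k₀ l₀ : ℤ} (h : Y.n k₀ l₀ = Y'.n k₀ l₀) : Y = Y' := by
  have e := (hB.isBacklundField h₁ h₂ h₀ hY).eq_of_eq hX ((isNonresonantCos_iff h₀).2 hres)
    (hB'.isBacklundField h₁ h₂ h₀ hY') (k₀ := k₀) (l₀ := l₀) (by rw [h])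
  rw [isBacklund_iff h₁ h₂ h₀] at hB hB'
  have e' : ∀ k l, Real.sign α • Y.n k l = Real.sign α • Y'.n k l := fun k l =>
    congrFun (congrFun e k) l
  ext1
  · funext k l
    rw [(hB k l).2, (hB' k l).2, e']
  · funext k l
    rw [← sign_smul_sign_smul h₀ (Y.n k l), e', sign_smul_sign_smul h₀]

theorem exists_backlund {X : GaussNet} (hX : X.IsLax) {α : ℝ} (h₁ : -Real.pi < α)
    (h₂ : α < Real.pi) (h₀ : α ≠ 0) (k₀ l₀ : ℤ) {ν : E3} (hν : ‖ν‖ = 1)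
    (hang : InnerProductGeometry.angle (X.n k₀ l₀) ν = |α|) :
    ∃ Y : GaussNet, Y.IsCKNet ∧ IsBacklund α X Y ∧ Y.n k₀ l₀ = ν := by
  rw [angle_eq_abs_iff h₁ h₂ (X.norm_n _ _) hν] at hang
  obtain ⟨m, hm, hm₀⟩ := exists_isBacklundField hX (sign_mul_cos_mem_Ioo h₁ h₂ h₀) k₀ l₀
    (norm_sign_smul h₀ hν) (by rw [inner_smul_right, hang])
  refine ⟨(X.transform m hm.norm_eq_one).signSMul α h₀,
    ((hm.isLax hX).signSMul h₀).isCKNet, ?_, ?_⟩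
  · rw [isBacklund_iff h₁ h₂ h₀]
    intro k l
    simp only [GaussNet.signSMul, transform, sign_smul_sign_smul h₀]
    exact ⟨hm.inner_eq k l, trivial⟩
  · simp only [GaussNet.signSMul, transform, hm₀, sign_smul_sign_smul h₀]

/-- Permutability: unless they agree up to the orientation of the Gauss map, two Bäcklund transforms
of `X` have a unique common transform with exchanged parameters. -/
theorem existsUnique_permutability {X : GaussNet} (hX : X.IsLax) {α β : ℝ}
    (hα₁ : -Real.pi < α) (hα₂ : α < Real.pi) (hα₀ : α ≠ 0)
    (hβ₁ : -Real.pi < β) (hβ₂ : β < Real.pi) (hβ₀ : β ≠ 0)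
    (hres : X.IsNonresonant α) {Y Z : GaussNet}
    (hY : Y.IsCKNet) (hXY : IsBacklund α X Y) (hZ : Z.IsCKNet) (hXZ : IsBacklund β X Z)
    (hne : ¬ (Y.f = Z.f ∧ (Y.n = Z.n ∨ Y.n = -Z.n))) :
    ∃! W : GaussNet, W.IsCKNet ∧ IsBacklund β Y W ∧ IsBacklund α Z W := by
  have hu := hXY.isBacklundField hα₁ hα₂ hα₀ hY
  have hv := hXZ.isBacklundField hβ₁ hβ₂ hβ₀ hZ
  have hXY' := (isBacklund_iff hα₁ hα₂ hα₀).1 hXY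
  have hXZ' := (isBacklund_iff hβ₁ hβ₂ hβ₀).1 hXZ
  -- If the two fields met at one vertex, they would be equal by unique continuation.
  have huv : ∀ k l, Real.sign α • Y.n k l ≠ Real.sign β • Z.n k l := by
    intro k₀ l₀ h
    have hcd : Real.sign α * Real.cos α = Real.sign β * Real.cos β := by
      rw [← hu.inner_eq k₀ l₀, ← hv.inner_eq k₀ l₀, h]
    rw [← hcd] at hv
    have e := hu.eq_of_eq hX ((isNonresonantCos_iff hα₀).2 hres) hv h
    have e' : ∀ k l, Real.sign α • Y.n k l = Real.sign β • Z.n k l := fun k l =>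
      congrFun (congrFun e k) l
    refine hne ⟨?_, ?_⟩
    · funext k l
      rw [(hXY' k l).2, (hXZ' k l).2, e']
    · rcases Real.sign_apply_eq_of_ne_zero α hα₀ with hα | hα <;>
        rcases Real.sign_apply_eq_of_ne_zero β hβ₀ with hβ | hβ <;>
        simp only [hα, hβ, neg_smul, one_smul, neg_inj] at e'
      · exact Or.inl (funext fun k => funext fun l => e' k l)
      · exact Or.inr (funext fun k => funext fun l => neg_eq_iff_eq_neg.1 (e' k l))
      · exact Or.inr (funext fun k => funext fun l => e' k l)
      · exact Or.inl (funext fun k => funext fun l => e' k l)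
  choose w hw huw hvw hB using fun k l => exists_permutability (X.norm_n k l)
    (hu.norm_eq_one k l) (hv.norm_eq_one k l) (huv k l)
  have huw' : ∀ k l, inner ℝ (Real.sign α • Y.n k l) (w k l) = Real.sign β * Real.cos β :=
    fun k l => (huw k l).trans (hv.inner_eq k l)
  have hvw' : ∀ k l, inner ℝ (Real.sign β • Z.n k l) (w k l) = Real.sign α * Real.cos α :=
    fun k l => (hvw k l).trans (hu.inner_eq k l)
  have hwf := hu.permutability hX hv huv hw huw' hB
  have hpt := fun k l => (cross_add_cross_eq (huw k l) (hvw k l)).2 (hB k l)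
  refine ⟨(((X.transform _ hu.norm_eq_one).transform w hw).signSMul α hα₀).signSMul β hβ₀,
    ⟨(((hwf.isLax (hu.isLax hX)).signSMul hα₀).signSMul hβ₀).isCKNet, ?_, ?_⟩, ?_⟩
  · rw [isBacklund_iff hβ₁ hβ₂ hβ₀]
    intro k l
    simp only [GaussNet.signSMul, transform, sign_smul_sign_smul hβ₀]
    rw [inner_smul_right_eq_left, cross_smul_right_eq_left _ (Y.n k l), (hXY' k l).2]
    exact ⟨huw' k l, rfl⟩
  · rw [isBacklund_iff hα₁ hα₂ hα₀]
    intro k l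
    simp only [GaussNet.signSMul, transform, smul_comm (Real.sign β) (Real.sign α),
      sign_smul_sign_smul hα₀]
    rw [inner_smul_right_eq_left, cross_smul_right_eq_left _ (Z.n k l), (hXZ' k l).2, add_assoc,
      add_assoc, hpt]
    exact ⟨hvw' k l, rfl⟩
  · rintro W ⟨-, hYW, hZW⟩
    rw [isBacklund_iff hβ₁ hβ₂ hβ₀] at hYW
    rw [isBacklund_iff hα₁ hα₂ hα₀] at hZW
    have hW : ∀ k l, W.n k l = Real.sign β • Real.sign α • w k l ∧
        W.f k l = X.f k l + cross (X.n k l) (Real.sign α • Y.n k l) +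
          cross (Real.sign α • Y.n k l) (w k l) := by
      intro k l
      obtain ⟨ω, hω⟩ : ∃ ω, W.n k l = Real.sign β • Real.sign α • ω :=
        ⟨Real.sign α • Real.sign β • W.n k l, by
          rw [sign_smul_sign_smul hα₀, sign_smul_sign_smul hβ₀]⟩
      have hy := hYW k l
      have hz := hZW k l
      rw [hω, sign_smul_sign_smul hβ₀, inner_smul_right_eq_left, cross_smul_right_eq_left,
        (hXY' k l).2] at hy
      rw [hω, smul_comm (Real.sign β) (Real.sign α), sign_smul_sign_smul hα₀,
        inner_smul_right_eq_left, cross_smul_right_eq_left, (hXZ' k l).2] at hz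
      have hpt' := hy.2.symm.trans hz.2
      rw [add_assoc, add_assoc, add_right_inj, cross_add_cross_eq
        (hy.1.trans (hv.inner_eq k l).symm) (hz.1.trans (hu.inner_eq k l).symm), ← hB k l] at hpt'
      have hωw : ω = w k l := quat_injective
        (mul_right_cancel₀ (sub_ne_zero.2 (quat_injective.ne (huv k l))) hpt')
      rw [hωw] at hω hy
      exact ⟨hω, hy.2⟩
    ext1
    · funext k l
      exact (hW k l).2
    · funext k l
      exact (hW k l).1

end GaussNet

theorem mainTheorem3 (X : GaussNet) (hX : X.IsCKNet) (hreg : X.IsNondegenerate) :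
    (∀ α : ℝ, -Real.pi < α → α < Real.pi → α ≠ 0 →
      ∀ (k₀ l₀ : ℤ) (ν : E3), ‖ν‖ = 1 → InnerProductGeometry.angle (X.n k₀ l₀) ν = |α| →
        (∃ Y : GaussNet, Y.IsCKNet ∧ GaussNet.IsBacklund α X Y ∧ Y.n k₀ l₀ = ν) ∧
        (X.IsNonresonant α →
          ∃! Y : GaussNet, Y.IsCKNet ∧ GaussNet.IsBacklund α X Y ∧ Y.n k₀ l₀ = ν)) ∧
    (∀ α β : ℝ, -Real.pi < α → α < Real.pi → α ≠ 0 → -Real.pi < β → β < Real.pi → β ≠ 0 →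
      X.IsNonresonant α → X.IsNonresonant β →
      ∀ Y Z : GaussNet, Y.IsCKNet → GaussNet.IsBacklund α X Y →
        Z.IsCKNet → GaussNet.IsBacklund β X Z →
        ¬ (Y.f = Z.f ∧ (Y.n = Z.n ∨ Y.n = -Z.n)) →
          ∃! W : GaussNet, W.IsCKNet ∧ GaussNet.IsBacklund β Y W ∧
            GaussNet.IsBacklund α Z W) := by
  have hL := hX.isLax hreg
  refine ⟨fun α h₁ h₂ h₀ k₀ l₀ ν hν hang => ?_, ?_⟩
  · have hex := GaussNet.exists_backlund hL h₁ h₂ h₀ k₀ l₀ hν hang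
    refine ⟨hex, fun hres => ?_⟩
    obtain ⟨Y, hY, hB, hYν⟩ := hex
    exact ⟨Y, ⟨hY, hB, hYν⟩, fun Y' ⟨hY', hB', hYν'⟩ =>
      GaussNet.backlund_unique hL h₁ h₂ h₀ hres hY' hB' hY hB (hYν'.trans hYν.symm)⟩
  · intro α β hα₁ hα₂ hα₀ hβ₁ hβ₂ hβ₀ hα _ Y Z hY hXY hZ hXZ hne
    exact GaussNet.existsUnique_permutability hL hα₁ hα₂ hα₀ hβ₁ hβ₂ hβ₀ hα hY hXY hZ hXZ hne
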